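/- Let $k\ge 2$ be an integer and let $Q=[a,b,c]$, $Q(X,Y)=aX^2+bXY+cY^2$ with $a,b,c\in\mathbb{Z}$, be a positive-definite integral binary quadratic form of discriminant $b^2-4ac=-D<0$. Let $[Q]$ be its $\mathrm{SL}_2(\mathbb{Z})$-equivalence class and let $\tau_Q=\frac{-b+i\sqrt{D}}{2a}$ be the root of $Q(z,1)$ in the upper half-plane $\mathbb{H}$. For $z=x+iy\in\mathbb{H}$ and $\mathcal{Q}=[a',b',c']\in[Q]$ put $\mathcal{Q}_z:=y^{-1}(a'|z|^2+b'x+c')$, and define $$f_Q(z):=D^{\frac k2}\sum_{\mathcal{Q}\in[Q]}\mathcal{Q}(z,1)^{-k},\qquad \mathcal{G}_Q(z):=D^{\frac{1-k}{2}}\sum_{\mathcal{Q}\in[Q]}\mathcal{Q}(z,1)^{k-1}\int_0^{\operatorname{arctanh}\left(\frac{\sqrt D}{\mathcal{Q}_z}\right)}\sinh^{2k-2}(\theta)\,d\theta .$$ In the sum for $\mathcal{G}_Q(z)$, a term with $\mathcal{Q}(z,1)=0$ (which occurs only for $z$ in the orbit $\mathrm{SL}_2(\mathbb{Z})\tau_Q$)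 is read as $0$. A polar harmonic Maass form of weight $\kappa\in\mathbb{Z}\setminus\{1\}$ (on $\mathrm{SL}_2(\mathbb{Z})$) is a function $\mathcal{F}:\mathbb{H}\to\mathbb{C}$ which is real analytic outside a set of points without accumulation point in $\mathbb{H}$ and satisfies: (1) $(\mathcal F|_\kappa M)(z):=(\gamma z+\delta)^{-\kappa}\mathcal{F}(Mz)=\mathcal{F}(z)$ for all $M=\left(\begin{smallmatrix}\alpha&\beta\\ \gamma&\delta\end{smallmatrix}\right)\in\mathrm{SL}_2(\mathbb{Z})$; (2) outside that set $\mathcal{F}$ is annihilated by $\Delta_\kappa=-y^2\left(\frac{\partial^2}{\partial x^2}+\frac{\partial^2}{\partial y^2}\right)+i\kappa y\left(\frac{\partial}{\partial x}+i\frac{\partial}{\partial y}\right)$; (3) for every $\mathfrak{z}\in\mathbb{H}$ there is an integer $n\ge 0$ such that $(z-\mathfrak{z})^n\mathcal{F}(z)$ is bounded in some neighborhood of $\mathfrak{z}$; (4) $\mathcal{F}$ grows at most linear exponentially towards the cusp, i.e. for all $M\in\mathrm{SL}_2(\mathbb{Z})$, $(\mathcal{F}|_\kappa M)(z)=O(e^{Ay})$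 as $y\to\infty$, uniformly in $x$, for some real $A$. Then both series converge absolutely for every $z\in\mathbb{H}\setminus\mathrm{SL}_2(\mathbb{Z})\tau_Q$, and $\mathcal{G}_Q$ is a polar harmonic Maass form of weight $2-2k$. Its singularities are exactly the points of the orbit $\mathrm{SL}_2(\mathbb{Z})\tau_Q$: it is real analytic at every other point of $\mathbb{H}$, and it is unbounded in every neighborhood of each point of the orbit. Moreover, with $$\xi_\kappa:=2iy^\kappa\,\overline{\frac{\partial}{\partial\overline z}},\qquad \mathcal{D}:=\frac{1}{2\pi i}\frac{\partial}{\partial z},$$ we have, on $\mathbb{H}\setminus\mathrm{SL}_2(\mathbb{Z})\tau_Q$, $$\xi_{2-2k}(\mathcal{G}_Q)=f_Q,\qquad \mathcal{D}^{2k-1}(\mathcal{G}_Q)=-\frac{(2k-2)!}{(4\pi)^{2k-1}}\,f_Q .$$ -/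

import Mathlib

open scoped MatrixGroups UpperHalfPlane ModularForm ComplexConjugate Topology

noncomputable section

namespace PolarMaass

/-! ## Differential operators on functions on the upper half-plane -/

/-- `∂F/∂x`. -/
def dx (F : ℍ → ℂ) : ℍ → ℂ :=
  fun z => fderiv ℝ (F ∘ UpperHalfPlane.ofComplex) (z : ℂ) 1

/-- `∂F/∂y`. -/
def dy (F : ℍ → ℂ) : ℍ → ℂ :=
  fun z => fderiv ℝ (F ∘ UpperHalfPlane.ofComplex) (z : ℂ) Complex.I

/-- The Wirtinger derivative `∂F/∂z = (∂F/∂x - i ∂F/∂y) / 2`. -/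
def dz (F : ℍ → ℂ) : ℍ → ℂ :=
  fun z => (dx F z - Complex.I * dy F z) / 2

/-- The Wirtinger derivative `∂F/∂z̄ = (∂F/∂x + i ∂F/∂y) / 2`. -/
def dzbar (F : ℍ → ℂ) : ℍ → ℂ :=
  fun z => (dx F z + Complex.I * dy F z) / 2

/-- The weight `κ` hyperbolic Laplacian
`Δ_κ = -y² (∂²/∂x² + ∂²/∂y²) + i κ y (∂/∂x + i ∂/∂y)`. -/
def hypLaplacian (κ : ℤ) (F : ℍ → ℂ) : ℍ → ℂ :=
  fun z => -((z.im : ℂ) ^ 2) * (dx (dx F) z + dy (dy F) z)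
    + Complex.I * (κ : ℂ) * (z.im : ℂ) * (dx F z + Complex.I * dy F z)

/-- The operator `ξ_κ F = 2 i y^κ · conj (∂F/∂z̄)`. -/
def xi (κ : ℤ) (F : ℍ → ℂ) : ℍ → ℂ :=
  fun z => 2 * Complex.I * (z.im : ℂ) ^ κ * conj (dzbar F z)

/-- The operator `𝒟 = (1 / (2 π i)) ∂/∂z`. -/
def calD (F : ℍ → ℂ) : ℍ → ℂ :=
  fun z => 1 / (2 * (Real.pi : ℂ) * Complex.I) * dz F z

/-! ## Polar harmonic Maass forms -/

/-- The points at which `F` is not real analytic. -/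
def nonanalyticSet (F : ℍ → ℂ) : Set ℍ :=
  {z | ¬ AnalyticAt ℝ (F ∘ UpperHalfPlane.ofComplex) (z : ℂ)}

/-- `F` is bounded in some neighbourhood of `w`. -/
def BoundedNear (F : ℍ → ℂ) (w : ℍ) : Prop :=
  ∃ C : ℝ, ∀ᶠ z in 𝓝 w, ‖F z‖ ≤ C

/-- Polar harmonic Maass forms of integral weight `κ` on `Γ₀(N)`. -/
structure IsPolarHarmonicMaassForm (κ : ℤ) (N : ℕ) (F : ℍ → ℂ) : Prop where
  /-- `F` is real analytic outside of a set without accumulation points in `ℍ`. -/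
  discrete : ∀ w : ℍ, ∀ᶠ z in 𝓝[≠] w, z ∉ nonanalyticSet F
  /-- `F` is modular of weight `κ` for `Γ₀(N)`. -/
  modular : ∀ M ∈ CongruenceSubgroup.Gamma0 N, F ∣[κ] M = F
  /-- `F` is harmonic away from its singularities. -/
  harmonic : ∀ z ∉ nonanalyticSet F, hypLaplacian κ F z = 0
  /-- All singularities of `F` in `ℍ` are of finite order. -/
  polar : ∀ w : ℍ, ∃ n : ℕ, BoundedNear (fun z => ((z : ℂ) - (w : ℂ)) ^ n * F z) w
  /-- `F` grows at most linear exponentially towards every cusp. -/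
  growth : ∀ M : SL(2, ℤ), ∃ A B Y : ℝ, ∀ z : ℍ, Y ≤ z.im →
    ‖(F ∣[κ] M) z‖ ≤ B * Real.exp (A * z.im)

/-! ## Integral binary quadratic forms -/

/-- The integral binary quadratic form `[a, b, c]`, i.e. `a X² + b X Y + c Y²`. -/
@[ext]
structure IntBQF where
  a : ℤ
  b : ℤ
  c : ℤ

namespace IntBQF

/-- `Q(X, Y) = a X² + b X Y + c Y²`, evaluated in any commutative ring. -/
def eval {R : Type*} [CommRing R] (Q : IntBQF) (X Y : R) : R :=
  (Q.a : R) * X ^ 2 + (Q.b : R) * X * Y + (Q.c : R) * Y ^ 2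

/-- The discriminant `b² - 4 a c`. -/
def disc (Q : IntBQF) : ℤ := Q.b ^ 2 - 4 * Q.a * Q.c

/-- The absolute value `D` of the discriminant `-D` (of a positive-definite form). -/
def absDisc (Q : IntBQF) : ℝ := -(Q.disc : ℝ)

def PosDef (Q : IntBQF) : Prop :=
  ∀ x y : ℝ, (x ≠ 0 ∨ y ≠ 0) → 0 < Q.eval x y

/-- The form `(Q ∘ M)(X, Y) = Q(α X + β Y, γ X + δ Y)` for `M = (α, β; γ, δ)`. -/
def comp (Q : IntBQF) (M : SL(2, ℤ)) : IntBQF where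
  a := Q.a * M 0 0 ^ 2 + Q.b * M 0 0 * M 1 0 + Q.c * M 1 0 ^ 2
  b := 2 * Q.a * M 0 0 * M 0 1 + Q.b * (M 0 0 * M 1 1 + M 0 1 * M 1 0)
    + 2 * Q.c * M 1 0 * M 1 1
  c := Q.a * M 0 1 ^ 2 + Q.b * M 0 1 * M 1 1 + Q.c * M 1 1 ^ 2

theorem eval_comp {R : Type*} [CommRing R] (Q : IntBQF) (M : SL(2, ℤ)) (X Y : R) :
    (Q.comp M).eval X Y =
      Q.eval ((M 0 0 : R) * X + (M 0 1 : R) * Y) ((M 1 0 : R) * X + (M 1 1 : R) * Y) := by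
  simp only [eval, comp]
  push_cast
  ring

/-- The `SL₂(ℤ)`-equivalence class `[Q]`. -/
def cls (Q : IntBQF) : Set IntBQF := {Q' | ∃ M : SL(2, ℤ), Q' = Q.comp M}

/-- `Q_z = y⁻¹ (a |z|² + b x + c)`. -/
def atPoint (Q : IntBQF) (z : ℍ) : ℝ :=
  (z.im)⁻¹ * ((Q.a : ℝ) * ‖(z : ℂ)‖ ^ 2 + (Q.b : ℝ) * z.re + (Q.c : ℝ))

theorem PosDef.a_pos {Q : IntBQF} (hQ : Q.PosDef) : (0 : ℝ) < Q.a := by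
  have h := hQ 1 0 (Or.inl one_ne_zero)
  simpa [eval] using h

theorem PosDef.absDisc_pos {Q : IntBQF} (hQ : Q.PosDef) : 0 < Q.absDisc := by
  have ha := hQ.a_pos
  have h := hQ (-(Q.b : ℝ)) (2 * Q.a) (Or.inr (by positivity))
  have h2 : Q.eval (-(Q.b : ℝ)) (2 * Q.a) = Q.a * Q.absDisc := by
    simp only [eval, absDisc, disc]
    push_cast
    ring
  rw [h2] at h
  exact (mul_pos_iff_of_pos_left ha).1 h

/-- The root `τ_Q = (-b + i √D) / (2a)` of `Q(z, 1)` in the upper half-plane. -/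
def tau (Q : IntBQF) (hQ : Q.PosDef) : ℍ :=
  ⟨⟨-(Q.b : ℝ) / (2 * Q.a), √Q.absDisc / (2 * Q.a)⟩, by
    have := hQ.a_pos
    have := Real.sqrt_pos.2 hQ.absDisc_pos
    change 0 < √Q.absDisc / (2 * Q.a)
    positivity⟩

theorem eval_tau (Q : IntBQF) (hQ : Q.PosDef) : Q.eval (Q.tau hQ : ℂ) 1 = 0 := by
  have ha := hQ.a_pos.ne'
  have hs := Real.sq_sqrt hQ.absDisc_pos.le
  apply Complex.ext
  · simp [eval, tau, pow_two]
    field_simp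
    rw [hs]
    simp only [absDisc, disc]
    push_cast
    ring
  · simp [eval, tau, pow_two]
    field_simp
    ring

end IntBQF

/-! ## The functions `f_Q` and `𝒢_Q` -/

/-- The summand `𝒬(z, 1)^{-k}` of `f_Q`. -/
def fTerm (k : ℕ) (Q : IntBQF) (z : ℍ) : ℂ := (Q.eval (z : ℂ) 1) ^ (-(k : ℤ))

/-- `f_Q(z) = D^{k/2} ∑_{𝒬 ∈ [Q]} 𝒬(z, 1)^{-k}`. -/
def fQ (k : ℕ) (Q : IntBQF) (z : ℍ) : ℂ :=
  ((Q.absDisc ^ ((k : ℝ) / 2) : ℝ) : ℂ) * ∑' Q' : Q.cls, fTerm k Q' z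

/-- The summand `𝒬(z, 1)^{k-1} ∫_0^{artanh (√D / 𝒬_z)} sinh^{2k-2}(θ) dθ` of `𝒢_Q`
(all forms in a class have the same discriminant). -/
def GTerm (k : ℕ) (Q : IntBQF) (z : ℍ) : ℂ :=
  (Q.eval (z : ℂ) 1) ^ (k - 1) *
    ((∫ θ in (0 : ℝ)..Real.artanh (√Q.absDisc / Q.atPoint z),
      Real.sinh θ ^ (2 * k - 2) : ℝ) : ℂ)

/-- `𝒢_Q(z) = D^{(1-k)/2} ∑_{𝒬 ∈ [Q]} 𝒬(z, 1)^{k-1} ∫_0^{artanh (√D / 𝒬_z)} sinh^{2k-2}(θ) dθ`. -/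
def GQ (k : ℕ) (Q : IntBQF) (z : ℍ) : ℂ :=
  ((Q.absDisc ^ ((1 - (k : ℝ)) / 2) : ℝ) : ℂ) * ∑' Q' : Q.cls, GTerm k Q' z

end PolarMaass

end

open PolarMaass

/-!
For a positive-definite form `𝒬 = [a, b, c]` of discriminant `-D` put `q = 𝒬(z, 1)`, `n = k - 1`
and let `θ = artanh (√D / 𝒬_z)` be the angle in the summand `qⁿ ∫_0^θ sinh^{2n}` of `𝒢_Q`. The
identity `|q|² = y² (𝒬_z² - D)` gives `sinh θ = √D y / |q|`, and `θ` satisfies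
`∂̄θ = i √D / (2 q̄)`, `∂θ = -i √D / (2 q)` (`hasWirtinger_angle`). Three facts about the summand
follow.

* Its `∂̄`-derivative is a constant times `y^{2n} q̄^{-n-1}` (`hasWirtinger_term`); this is the
  formula for `ξ`, and it makes the summand harmonic.
* It is bounded by `(√D y)^{2n+1} |q|^{-n-1}` (`norm_term_le`), while near the zero of `q` it grows
  like `|q|^{-n}` (`le_norm_term`). So everything about convergence, growth and singularities is
  reduced to lower bounds for `|q|`.
* `∂^{2n+1}` maps it to a constant times `q^{-n-1}` (`wz_iterate_term`): by the recursion for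
  `∫ sinh^{2n}` it equals a constant times `qⁿ ℓ`, with `ℓ` the holomorphic part of `θ`, up to a
  polynomial of degree at most `2n` in `z` with antiholomorphic coefficients, and
  `(qⁿ ℓ)^{(2n+1)}` is computed by induction on `n` from the Leibniz rule
  (`iterate_deriv_eval_pow_mul`, a case of Bol's identity).

The passage from the summands to the series is `tsum_of_wzbar_eq`. If `∂̄gᵢ = c y^m conj fᵢ` with
`fᵢ` holomorphic on a disc, then `gᵢ` is the sum of `∑ⱼ zʲ conj Fᵢⱼ`, where the `Fᵢⱼ` are primitives
of multiples of `z^{m-j} fᵢ`, and a holomorphic function `hᵢ`, all bounded by the sizes of `fᵢ` and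
`gᵢ`. Hence a normally convergent sum of the `gᵢ` has the same shape. It is therefore real
analytic, `∂̄` may be applied termwise, and `∂^{m+1}`, which kills the polynomial part, may be
applied termwise too.

Convergence: `|q|` is at least a constant times `a + c`, locally uniformly in `z` for all but
finitely many forms of the class (`exists_lower_bound`), and for all of them if `|x| ≤ 1` and `y` is large
(`size_le_norm_eval`). The sum of `(a + c)^{-k}` over a class converges (`summable_inv_size_pow`),
since it is dominated by an Eisenstein-type sum over the first columns of matrices in `SL₂(ℤ)` times
a sum over translations. At a point of the orbit of `τ_Q` exactly one form of the class vanishes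
(`eq_of_common_root`), so one summand carries the singularity and the rest of the series is bounded.
-/

noncomputable section

namespace PolarMaass

open Metric

/-! ### Wirtinger calculus -/

/-- `g` is real differentiable at `z` with differential `A dz + B dz̄`; thus `A` and `B` are the
Wirtinger derivatives `∂g/∂z` and `∂g/∂z̄` at `z`. -/
def HasWirtinger (g : ℂ → ℂ) (A B z : ℂ) : Prop :=
  HasFDerivAt g (A • ContinuousLinearMap.id ℝ ℂ + B • (Complex.conjCLE : ℂ →L[ℝ] ℂ)) z

/-- The Wirtinger derivative `∂g/∂z` of a function on `ℂ`. -/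
def wz (g : ℂ → ℂ) (z : ℂ) : ℂ := (fderiv ℝ g z 1 - Complex.I * fderiv ℝ g z Complex.I) / 2

/-- The Wirtinger derivative `∂g/∂z̄` of a function on `ℂ`. -/
def wzbar (g : ℂ → ℂ) (z : ℂ) : ℂ := (fderiv ℝ g z 1 + Complex.I * fderiv ℝ g z Complex.I) / 2

namespace HasWirtinger

variable {f g : ℂ → ℂ} {A B A' B' z : ℂ}

theorem wz_eq (h : HasWirtinger g A B z) : wz g z = A := by
  have hI := Complex.I_mul_I
  simp only [wz, HasFDerivAt.fderiv h]
  simp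
  linear_combination (B - A) / 2 * hI

theorem wzbar_eq (h : HasWirtinger g A B z) : wzbar g z = B := by
  have hI := Complex.I_mul_I
  simp only [wzbar, HasFDerivAt.fderiv h]
  simp
  linear_combination (A - B) / 2 * hI

theorem of_eq (h : HasWirtinger g A B z) (hA : A = A') (hB : B = B') : HasWirtinger g A' B' z := by
  subst hA hB
  exact h

theorem congr_of_eventuallyEq (h : HasWirtinger g A B z) (hfg : f =ᶠ[𝓝 z] g) :
    HasWirtinger f A B z :=
  HasFDerivAt.congr_of_eventuallyEq h hfg

theorem add (hf : HasWirtinger f A B z) (hg : HasWirtinger g A' B' z) :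
    HasWirtinger (fun z => f z + g z) (A + A') (B + B') z := by
  refine (HasFDerivAt.add hf hg).congr_fderiv ?_
  ext; simp; ring

theorem mul (hf : HasWirtinger f A B z) (hg : HasWirtinger g A' B' z) :
    HasWirtinger (fun z => f z * g z) (f z * A' + g z * A) (f z * B' + g z * B) z := by
  refine (HasFDerivAt.mul hf hg).congr_fderiv ?_
  ext; simp; ring

theorem const (c : ℂ) : HasWirtinger (fun _ => c) 0 0 z := by
  refine (hasFDerivAt_const c z).congr_fderiv ?_
  ext; simp

theorem const_mul (c : ℂ) (hf : HasWirtinger f A B z) :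
    HasWirtinger (fun z => c * f z) (c * A) (c * B) z :=
  ((const c).mul hf).of_eq (by ring) (by ring)

theorem sub (hf : HasWirtinger f A B z) (hg : HasWirtinger g A' B' z) :
    HasWirtinger (fun z => f z - g z) (A - A') (B - B') z := by
  refine (HasFDerivAt.sub hf hg).congr_fderiv ?_
  ext; simp; ring

theorem sum {ι : Type*} (s : Finset ι) {f : ι → ℂ → ℂ} {A B : ι → ℂ}
    (h : ∀ i ∈ s, HasWirtinger (f i) (A i) (B i) z) :
    HasWirtinger (fun z => ∑ i ∈ s, f i z) (∑ i ∈ s, A i) (∑ i ∈ s, B i) z := by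
  classical
  induction s using Finset.induction_on with
  | empty => simpa using const 0
  | insert a s ha ih =>
    simp only [Finset.sum_insert ha]
    exact (h a (by simp)).add (ih fun i hi => h i (by simp [hi]))

theorem of_hasDerivAt (h : HasDerivAt f A z) : HasWirtinger f A 0 z := by
  refine (h.hasFDerivAt.restrictScalars ℝ).congr_fderiv ?_
  ext; simp [mul_comm]

theorem hasDerivAt (h : HasWirtinger f A 0 z) : HasDerivAt f A z := by
  rw [hasDerivAt_iff_hasFDerivAt]
  refine hasFDerivAt_of_restrictScalars ℝ h ?_
  ext; simp [mul_comm]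

theorem conjugate (h : HasWirtinger f A B z) :
    HasWirtinger (fun z => conj (f z)) (conj B) (conj A) z := by
  refine ((Complex.conjCLE : ℂ →L[ℝ] ℂ).hasFDerivAt.comp z h).congr_fderiv ?_
  ext; simp; ring

theorem pow (h : HasWirtinger f A B z) (n : ℕ) :
    HasWirtinger (fun z => f z ^ n) (n * f z ^ (n - 1) * A) (n * f z ^ (n - 1) * B) z := by
  refine (HasFDerivAt.pow (n := n) h).congr_fderiv ?_
  ext; simp; ring

/-- Chain rule for a real function of a real-valued function. -/
theorem real_comp {u : ℂ → ℝ} {φ : ℝ → ℝ} {φ' : ℝ} (hu : HasWirtinger (fun z => (u z : ℂ)) A B z)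
    (hφ : HasDerivAt φ φ' (u z)) :
    HasWirtinger (fun z => ((φ (u z) : ℝ) : ℂ)) (φ' * A) (φ' * B) z := by
  have h1 : HasFDerivAt u (Complex.reCLM.comp (A • ContinuousLinearMap.id ℝ ℂ +
      B • (Complex.conjCLE : ℂ →L[ℝ] ℂ))) z := Complex.reCLM.hasFDerivAt.comp z hu
  have h2 := (Complex.ofRealCLM.hasFDerivAt.comp z h1).unique hu
  have h3 := Complex.ofRealCLM.hasFDerivAt.comp z (hφ.comp_hasFDerivAt z h1)
  refine HasFDerivAt.congr_fderiv h3 ?_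
  ext v
  have h4 := DFunLike.congr_fun h2 v
  have h5 : ((φ' * A) • ContinuousLinearMap.id ℝ ℂ +
      ((φ' * B) • (Complex.conjCLE : ℂ →L[ℝ] ℂ))) v =
      (φ' : ℂ) * ((A • ContinuousLinearMap.id ℝ ℂ + B • (Complex.conjCLE : ℂ →L[ℝ] ℂ)) v) := by
    simp; ring
  rw [h5, ← h4]
  simp [-Complex.add_re, -Complex.mul_re, mul_add]

theorem im : HasWirtinger (fun z => (z.im : ℂ)) (1 / (2 * Complex.I)) (-1 / (2 * Complex.I)) z := by
  have h1 := of_hasDerivAt (hasDerivAt_id z)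
  have h := (h1.sub h1.conjugate).const_mul (1 / (2 * Complex.I))
  simp only [id, map_zero, map_one, sub_zero, zero_sub] at h
  refine (h.of_eq (by ring) (by ring)).congr_of_eventuallyEq (Filter.Eventually.of_forall ?_)
  intro w
  beta_reduce
  rw [Complex.sub_conj]
  field_simp
  push_cast
  ring

theorem re : HasWirtinger (fun z => (z.re : ℂ)) (1 / 2) (1 / 2) z := by
  have h1 := of_hasDerivAt (hasDerivAt_id z)
  have h := (h1.add h1.conjugate).const_mul (1 / 2)
  simp only [id, map_zero, map_one, add_zero, zero_add, mul_one] at h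
  refine h.congr_of_eventuallyEq (Filter.Eventually.of_forall ?_)
  intro w
  beta_reduce
  rw [Complex.add_conj]
  push_cast
  ring

end HasWirtinger

theorem wz_congr {f g : ℂ → ℂ} {z : ℂ} (h : f =ᶠ[𝓝 z] g) : wz f z = wz g z := by
  simp only [wz, h.fderiv_eq]

theorem wzbar_congr {f g : ℂ → ℂ} {z : ℂ} (h : f =ᶠ[𝓝 z] g) : wzbar f z = wzbar g z := by
  simp only [wzbar, h.fderiv_eq]

/-- Iterated Wirtinger derivatives on an open set depend only on the values there. -/
theorem wz_iterate_congr {f g : ℂ → ℂ} {U : Set ℂ} (hU : IsOpen U) (h : Set.EqOn f g U) (m : ℕ) :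
    Set.EqOn (wz^[m] f) (wz^[m] g) U := by
  induction m generalizing f g with
  | zero => exact h
  | succ m ih =>
    simp only [Function.iterate_succ_apply]
    exact ih fun z hz => wz_congr (h.eventuallyEq_of_mem (hU.mem_nhds hz))

theorem differentiableOn_iterate_deriv {h : ℂ → ℂ} {U : Set ℂ} (hU : IsOpen U)
    (hh : DifferentiableOn ℂ h U) (m : ℕ) : DifferentiableOn ℂ (deriv^[m] h) U := by
  induction m generalizing h with
  | zero => exact hh
  | succ m ih => exact ih (hh.deriv hU)

theorem hasDerivAt_of_differentiableOn {h : ℂ → ℂ} {U : Set ℂ} (hU : IsOpen U)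
    (hh : DifferentiableOn ℂ h U) {z : ℂ} (hz : z ∈ U) : HasDerivAt h (deriv h z) z :=
  (hh.differentiableAt (hU.mem_nhds hz)).hasDerivAt

/-- The polynomials in `z` of degree at most `d` whose coefficients are antiholomorphic on `U`. -/
def antiPoly (U : Set ℂ) (d : ℕ) : Submodule ℂ (ℂ → ℂ) :=
  Submodule.span ℂ {p | ∃ j ≤ d, ∃ Φ : ℂ → ℂ, DifferentiableOn ℂ Φ U ∧
    p = fun z => z ^ j * conj (Φ z)}

section antiPoly

variable {U : Set ℂ} {d e : ℕ} {p q : ℂ → ℂ}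

theorem monomial_mem_antiPoly {j : ℕ} (hj : j ≤ d) {Φ : ℂ → ℂ} (hΦ : DifferentiableOn ℂ Φ U) :
    (fun z => z ^ j * conj (Φ z)) ∈ antiPoly U d :=
  Submodule.subset_span ⟨j, hj, Φ, hΦ, rfl⟩

theorem conj_mem_antiPoly {Φ : ℂ → ℂ} (hΦ : DifferentiableOn ℂ Φ U) :
    (fun z => conj (Φ z)) ∈ antiPoly U d := by
  simpa using monomial_mem_antiPoly (d := d) (Nat.zero_le d) hΦ

theorem pow_mem_antiPoly {j : ℕ} (hj : j ≤ d) : (fun z => z ^ j) ∈ antiPoly U d := by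
  simpa using monomial_mem_antiPoly (U := U) hj (differentiableOn_const (1 : ℂ))

theorem mul_mem_antiPoly (hp : p ∈ antiPoly U d) (hq : q ∈ antiPoly U e) :
    p * q ∈ antiPoly U (d + e) := by
  have h := Submodule.mul_mem_mul hp hq
  rw [antiPoly, antiPoly, Submodule.span_mul_span] at h
  refine Submodule.span_mono ?_ h
  rintro _ ⟨_, ⟨i, hi, Φ, hΦ, rfl⟩, _, ⟨j, hj, Ψ, hΨ, rfl⟩, rfl⟩
  refine ⟨i + j, by omega, fun z => Φ z * Ψ z, hΦ.mul hΨ, ?_⟩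
  ext z
  simp
  ring

theorem pow_fun_mem_antiPoly (hp : p ∈ antiPoly U d) (m : ℕ) : p ^ m ∈ antiPoly U (m * d) := by
  induction m with
  | zero => simpa [Pi.one_def] using pow_mem_antiPoly (U := U) (le_refl 0)
  | succ m ih =>
    rw [pow_succ, Nat.succ_mul]
    exact mul_mem_antiPoly ih hp

theorem antiPoly_zero_hasWirtinger (hU : IsOpen U) (hp : p ∈ antiPoly U 0) :
    ∃ r : ℂ → ℂ, ∀ z ∈ U, HasWirtinger p 0 (r z) z := by
  induction hp using Submodule.span_induction with
  | mem p hp =>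
    obtain ⟨j, hj, Φ, hΦ, rfl⟩ := hp
    obtain rfl : j = 0 := by omega
    refine ⟨fun z => conj (deriv Φ z), fun z hz => ?_⟩
    simpa using (HasWirtinger.of_hasDerivAt (hasDerivAt_of_differentiableOn hU hΦ hz)).conjugate
  | zero => exact ⟨0, fun z _ => HasWirtinger.const 0⟩
  | add p q _ _ hp hq =>
    obtain ⟨r, hr⟩ := hp
    obtain ⟨r', hr'⟩ := hq
    exact ⟨r + r', fun z hz => ((hr z hz).add (hr' z hz)).of_eq (by simp) rfl⟩
  | smul c p _ hp =>
    obtain ⟨r, hr⟩ := hp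
    exact ⟨fun z => c * r z, fun z hz => ((hr z hz).const_mul c).of_eq (by simp) rfl⟩

theorem antiPoly_succ_hasWirtinger (hU : IsOpen U) (hp : p ∈ antiPoly U (d + 1)) :
    ∃ p' ∈ antiPoly U d, ∃ r : ℂ → ℂ, ∀ z ∈ U, HasWirtinger p (p' z) (r z) z := by
  induction hp using Submodule.span_induction with
  | mem p hp =>
    obtain ⟨j, hj, Φ, hΦ, rfl⟩ := hp
    refine ⟨(j : ℂ) • fun z => z ^ (j - 1) * conj (Φ z), Submodule.smul_mem _ _
      (monomial_mem_antiPoly (by omega) hΦ), fun z => z ^ j * conj (deriv Φ z), fun z hz => ?_⟩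
    have h1 := (HasWirtinger.of_hasDerivAt (hasDerivAt_of_differentiableOn hU hΦ hz)).conjugate
    have h2 := HasWirtinger.of_hasDerivAt (hasDerivAt_pow j z)
    refine (h2.mul h1).of_eq ?_ ?_ <;> simp
    ring
  | zero => exact ⟨0, Submodule.zero_mem _, 0, fun z _ => HasWirtinger.const 0⟩
  | add p q _ _ hp hq =>
    obtain ⟨p', hp', r, hr⟩ := hp
    obtain ⟨q', hq', r', hr'⟩ := hq
    exact ⟨p' + q', Submodule.add_mem _ hp' hq', r + r', fun z hz => (hr z hz).add (hr' z hz)⟩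
  | smul c p _ hp =>
    obtain ⟨p', hp', r, hr⟩ := hp
    exact ⟨c • p', Submodule.smul_mem _ _ hp', fun z => c * r z,
      fun z hz => (hr z hz).const_mul c⟩

/-- `∂^{d+1}` kills polynomials in `z` of degree at most `d` with antiholomorphic coefficients. -/
theorem wz_iterate_of_antiPoly (hU : IsOpen U) {g h : ℂ → ℂ} (hp : p ∈ antiPoly U d)
    (hh : DifferentiableOn ℂ h U) (hg : ∀ z ∈ U, g z = p z + h z) :
    Set.EqOn (wz^[d + 1] g) (deriv^[d + 1] h) U := by
  have key : ∀ {p p' r : ℂ → ℂ} {g h : ℂ → ℂ}, DifferentiableOn ℂ h U →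
      (∀ z ∈ U, g z = p z + h z) → (∀ z ∈ U, HasWirtinger p (p' z) (r z) z) →
      ∀ z ∈ U, wz g z = p' z + deriv h z := by
    intro p p' r g h hh hg hp z hz
    have h1 := (hp z hz).add (HasWirtinger.of_hasDerivAt (hasDerivAt_of_differentiableOn hU hh hz))
    exact (h1.congr_of_eventuallyEq
      (Set.EqOn.eventuallyEq_of_mem (s := U) hg (hU.mem_nhds hz))).wz_eq
  induction d generalizing p g h with
  | zero =>
    obtain ⟨r, hr⟩ := antiPoly_zero_hasWirtinger hU hp
    intro z hz
    simpa using key hh hg (p' := 0) hr z hz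
  | succ d ih =>
    obtain ⟨p', hp', r, hr⟩ := antiPoly_succ_hasWirtinger hU hp
    rw [Function.iterate_succ_apply, Function.iterate_succ_apply]
    exact ih hp' (hh.deriv hU) (key hh hg hr)

theorem analyticAt_of_antiPoly (hU : IsOpen U) (hp : p ∈ antiPoly U d) {z : ℂ} (hz : z ∈ U) :
    AnalyticAt ℝ p z := by
  induction hp using Submodule.span_induction with
  | mem p hp =>
    obtain ⟨j, hj, Φ, hΦ, rfl⟩ := hp
    have h1 : AnalyticAt ℝ Φ z := (hΦ.analyticAt (hU.mem_nhds hz)).restrictScalars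
    have h2 : AnalyticAt ℝ (fun z => conj (Φ z)) z :=
      ((Complex.conjCLE : ℂ →L[ℝ] ℂ).analyticAt _).comp h1
    exact (analyticAt_id.pow j).mul h2
  | zero => exact analyticAt_const
  | add p q _ _ hp hq => exact hp.add hq
  | smul c p _ hp => exact hp.const_smul

end antiPoly

/-! ### Series of functions with prescribed `∂̄`-derivative -/

theorem exists_primitive_bound {f : ℂ → ℂ} {z₀ : ℂ} {R u : ℝ}
    (hf : DifferentiableOn ℂ f (ball z₀ R)) (hu : ∀ z ∈ ball z₀ R, ‖f z‖ ≤ u) :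
    ∃ F : ℂ → ℂ, (∀ z ∈ ball z₀ R, HasDerivAt F (f z) z) ∧
      ∀ z ∈ ball z₀ R, ‖F z‖ ≤ u * R := by
  obtain ⟨F, h0, hF⟩ := hf.isExactOn_ball.with_val_at z₀ 0
  refine ⟨F, hF, fun z hz => ?_⟩
  have hz0 : z₀ ∈ ball z₀ R := mem_ball_self (dist_nonneg.trans_lt (mem_ball.1 hz))
  have h := (convex_ball z₀ R).norm_image_sub_le_of_norm_deriv_le (𝕜 := ℂ) (f := F) (C := u)
    (fun x hx => (hF x hx).differentiableAt)
    (fun x hx => by rw [(hF x hx).deriv]; exact hu x hx) hz0 hz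
  rw [h0, sub_zero] at h
  refine h.trans (mul_le_mul_of_nonneg_left ?_ ((norm_nonneg _).trans (hu z hz)))
  rw [← dist_eq_norm]
  exact (mem_ball.1 hz).le

/-- The coefficients in `c yⁿ = ∑ⱼ zʲ · conj (κⱼ zⁿ⁻ʲ)`, where `y = (z - z̄) / 2i`. -/
def imPowCoeff (c : ℂ) (n j : ℕ) : ℂ :=
  conj (c * (1 / (2 * Complex.I)) ^ n * (n.choose j : ℂ)) * (-1) ^ (n - j)

theorem sum_imPowCoeff (c : ℂ) (n : ℕ) (z w : ℂ) :
    ∑ j ∈ Finset.range (n + 1), z ^ j * conj (imPowCoeff c n j * z ^ (n - j) * w) =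
      c * (z.im : ℂ) ^ n * conj w := by
  have h1 : (z.im : ℂ) = 1 / (2 * Complex.I) * (z + -conj z) := by
    rw [← sub_eq_add_neg, Complex.sub_conj]
    field_simp
    push_cast
    ring
  rw [h1, mul_pow, add_pow, Finset.mul_sum, Finset.mul_sum, Finset.sum_mul]
  refine Finset.sum_congr rfl fun j _ => ?_
  simp only [imPowCoeff, map_mul, map_pow, Complex.conj_conj, map_neg, map_one]
  rw [neg_pow (conj z)]
  ring

/-- A function with `∂̄g = c yⁿ conj f` on a disc, `f` holomorphic, is the sum of a polynomial of
degree at most `n` in `z` with antiholomorphic coefficients and a holomorphic function, all of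
which are controlled by the size of `f` and `g`. -/
theorem exists_decomposition {g f A : ℂ → ℂ} {c : ℂ} {n : ℕ} {z₀ : ℂ} {R u : ℝ}
    (hf : DifferentiableOn ℂ f (ball z₀ R))
    (hg : ∀ z ∈ ball z₀ R, HasWirtinger g (A z) (c * (z.im : ℂ) ^ n * conj (f z)) z)
    (hfu : ∀ z ∈ ball z₀ R, ‖f z‖ ≤ u) :
    ∃ F : ℕ → ℂ → ℂ,
      (∀ j, ∀ z ∈ ball z₀ R, HasDerivAt (F j) (imPowCoeff c n j * z ^ (n - j) * f z) z) ∧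
      (∀ j, ∀ z ∈ ball z₀ R,
        ‖F j z‖ ≤ ‖imPowCoeff c n j‖ * (‖z₀‖ + R) ^ (n - j) * R * u) ∧
      DifferentiableOn ℂ
        (fun z => g z - ∑ j ∈ Finset.range (n + 1), z ^ j * conj (F j z)) (ball z₀ R) := by
  have hnorm : ∀ z ∈ ball z₀ R, ‖z‖ ≤ ‖z₀‖ + R := fun z hz => (norm_lt_of_mem_ball hz).le
  have key : ∀ j, ∃ F : ℂ → ℂ,
      (∀ z ∈ ball z₀ R, HasDerivAt F (imPowCoeff c n j * z ^ (n - j) * f z) z) ∧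
      ∀ z ∈ ball z₀ R, ‖F z‖ ≤ (‖imPowCoeff c n j‖ * (‖z₀‖ + R) ^ (n - j) * u) * R := by
    intro j
    refine exists_primitive_bound (by fun_prop) fun z hz => ?_
    rw [norm_mul, norm_mul, norm_pow]
    have h0 := hnorm z hz
    have h1 := hfu z hz
    have h2 := (norm_nonneg _).trans h0
    gcongr
  choose F hF hFu using key
  refine ⟨F, hF, fun j z hz => (hFu j z hz).trans_eq (by ring), fun z hz => ?_⟩
  have h1 := (hg z hz).sub (HasWirtinger.sum (Finset.range (n + 1)) fun j _ =>
    (HasWirtinger.of_hasDerivAt (hasDerivAt_pow j z)).mul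
      (HasWirtinger.of_hasDerivAt (hF j z hz)).conjugate)
  have h2 := h1.of_eq rfl (B' := 0) (by
    simp only [mul_zero, add_zero, sum_imPowCoeff, sub_self])
  exact h2.hasDerivAt.differentiableAt.differentiableWithinAt

theorem iterate_deriv_tendstoLocallyUniformlyOn {ι : Type*} {φ : Filter ι} {U : Set ℂ}
    (hU : IsOpen U) (m : ℕ) {F : ι → ℂ → ℂ} {f : ℂ → ℂ} (h : TendstoLocallyUniformlyOn F f φ U)
    (hF : ∀ i, DifferentiableOn ℂ (F i) U) :
    TendstoLocallyUniformlyOn (fun i => deriv^[m] (F i)) (deriv^[m] f) φ U := by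
  induction m generalizing F f with
  | zero => exact h
  | succ m ih =>
    exact ih (h.deriv (Filter.Eventually.of_forall hF) hU) fun i => (hF i).deriv hU

theorem iterate_deriv_finset_sum {ι : Type*} {U : Set ℂ} (hU : IsOpen U) (m : ℕ)
    {F : ι → ℂ → ℂ} (hF : ∀ i, DifferentiableOn ℂ (F i) U) (s : Finset ι) :
    Set.EqOn (deriv^[m] fun z => ∑ i ∈ s, F i z) (fun z => ∑ i ∈ s, deriv^[m] (F i) z) U := by
  induction m generalizing F with
  | zero => exact fun _ _ => rfl
  | succ m ih =>
    intro z hz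
    rw [Function.iterate_succ_apply]
    have h1 : Set.EqOn (deriv fun z => ∑ i ∈ s, F i z) (fun z => ∑ i ∈ s, deriv (F i) z) U :=
      fun z hz => deriv_fun_sum fun i _ => (hF i).differentiableAt (hU.mem_nhds hz)
    have h2 := (h1.eventuallyEq_of_mem (hU.mem_nhds hz)).iteratedDeriv_eq m
    rw [iteratedDeriv_eq_iterate, iteratedDeriv_eq_iterate] at h2
    rw [h2]
    exact ih (fun i => (hF i).deriv hU) hz

theorem hasSum_iterate_deriv {ι : Type*} {U : Set ℂ} (hU : IsOpen U) (m : ℕ) {F : ι → ℂ → ℂ}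
    {u : ι → ℝ} (hu : Summable u) (hF : ∀ i, DifferentiableOn ℂ (F i) U)
    (hFu : ∀ i, ∀ z ∈ U, ‖F i z‖ ≤ u i) {z : ℂ} (hz : z ∈ U) :
    HasSum (fun i => deriv^[m] (F i) z) (deriv^[m] (fun z => ∑' i, F i z) z) := by
  have h1 := (tendstoUniformlyOn_tsum hu hFu).tendstoLocallyUniformlyOn
  have h2 := iterate_deriv_tendstoLocallyUniformlyOn hU m h1
    fun s => DifferentiableOn.fun_sum fun i _ => hF i
  rw [HasSum]
  refine (h2.tendsto_at hz).congr fun s => ?_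
  exact iterate_deriv_finset_sum hU m hF s hz

/-- Termwise differentiation of a series `∑ gᵢ` with `∂̄gᵢ = c yⁿ conj fᵢ`, `fᵢ` holomorphic. No
bounds on derivatives are needed: the local decomposition of each `gᵢ` into antiholomorphic and
holomorphic pieces turns everything into locally uniform convergence of holomorphic functions. -/
theorem tsum_of_wzbar_eq {ι : Type*} {g f A : ι → ℂ → ℂ} {c : ℂ} {n : ℕ} {z₀ : ℂ} {R : ℝ}
    {u : ι → ℝ} (hu : Summable u) (hf : ∀ i, DifferentiableOn ℂ (f i) (ball z₀ R))
    (hg : ∀ i, ∀ z ∈ ball z₀ R, HasWirtinger (g i) (A i z) (c * (z.im : ℂ) ^ n * conj (f i z)) z)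
    (hfu : ∀ i, ∀ z ∈ ball z₀ R, ‖f i z‖ ≤ u i) (hgu : ∀ i, ∀ z ∈ ball z₀ R, ‖g i z‖ ≤ u i) :
    (∀ z ∈ ball z₀ R, AnalyticAt ℝ (fun z => ∑' i, g i z) z) ∧
    (∀ z ∈ ball z₀ R, ∃ A', HasWirtinger (fun z => ∑' i, g i z) A'
      (c * (z.im : ℂ) ^ n * conj (∑' i, f i z)) z) ∧
    ∀ z ∈ ball z₀ R,
      HasSum (fun i => wz^[n + 1] (g i) z) (wz^[n + 1] (fun z => ∑' i, g i z) z) := by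
  set B := ball z₀ R with hB
  have hBo : IsOpen B := isOpen_ball
  choose F hF hFu hh using fun i => exists_decomposition (hf i) (hg i) (hfu i)
  set h : ι → ℂ → ℂ := fun i z => g i z - ∑ j ∈ Finset.range (n + 1), z ^ j * conj (F i j z)
    with hdef
  have hFd : ∀ i j, DifferentiableOn ℂ (F i j) B := fun i j z hz =>
    (hF i j z hz).differentiableAt.differentiableWithinAt
  -- bounds for the pieces of the decomposition
  have hFsum : ∀ j, Summable fun i => ‖imPowCoeff c n j‖ * (‖z₀‖ + R) ^ (n - j) * R * u i :=
    fun j => hu.mul_left _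
  have hnorm : ∀ z ∈ B, ‖z‖ ≤ ‖z₀‖ + R := fun z hz => (norm_lt_of_mem_ball hz).le
  set v : ι → ℝ := fun i => u i + ∑ j ∈ Finset.range (n + 1),
    (‖z₀‖ + R) ^ j * (‖imPowCoeff c n j‖ * (‖z₀‖ + R) ^ (n - j) * R * u i) with hv
  have hvsum : Summable v := hu.add (summable_sum fun j _ => (hFsum j).mul_left _)
  have hhu : ∀ i, ∀ z ∈ B, ‖h i z‖ ≤ v i := by
    intro i z hz
    refine (norm_sub_le _ _).trans (add_le_add (hgu i z hz) ?_)
    refine (norm_sum_le _ _).trans (Finset.sum_le_sum fun j _ => ?_)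
    rw [norm_mul, norm_pow, RCLike.norm_conj]
    exact mul_le_mul (pow_le_pow_left₀ (norm_nonneg _) (hnorm z hz) j) (hFu i j z hz)
      (norm_nonneg _) (pow_nonneg ((norm_nonneg _).trans (hnorm z hz)) _)
  -- the decomposition of the sum
  set Φ : ℕ → ℂ → ℂ := fun j z => ∑' i, F i j z with hΦ
  set H : ℂ → ℂ := fun z => ∑' i, h i z with hH
  have hΦd : ∀ j, DifferentiableOn ℂ (Φ j) B := fun j =>
    Complex.differentiableOn_tsum_of_summable_norm (hFsum j) (fun i => hFd i j) hBo
      fun i z hz => hFu i j z hz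
  have hHd : DifferentiableOn ℂ H B :=
    Complex.differentiableOn_tsum_of_summable_norm hvsum hh hBo hhu
  have hΦ' : ∀ j, ∀ z ∈ B, HasDerivAt (Φ j) (imPowCoeff c n j * z ^ (n - j) * ∑' i, f i z) z := by
    intro j z hz
    have h1 := Complex.hasSum_deriv_of_summable_norm (hFsum j) (fun i => hFd i j) hBo
      (fun i z hz => hFu i j z hz) hz
    have h2 := hasDerivAt_of_differentiableOn hBo (hΦd j) hz
    rw [← h1.tsum_eq] at h2
    rwa [← tsum_mul_left, ← tsum_congr fun i => (hF i j z hz).deriv]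
  have hsum : ∀ z ∈ B, ∑' i, g i z =
      (∑ j ∈ Finset.range (n + 1), z ^ j * conj (Φ j z)) + H z := by
    intro z hz
    have h1 : ∀ j, Summable fun i => F i j z := fun j =>
      Summable.of_norm_bounded (hFsum j) fun i => hFu i j z hz
    have h2 : Summable fun i => h i z := Summable.of_norm_bounded hvsum fun i => hhu i z hz
    have h3 : ∀ j, HasSum (fun i => z ^ j * conj (F i j z)) (z ^ j * conj (Φ j z)) := fun j =>
      (((h1 j).hasSum.map (starRingEnd ℂ) Complex.continuous_conj)).mul_left _
    have h4 := (hasSum_sum (s := Finset.range (n + 1)) fun j _ => h3 j).add h2.hasSum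
    rw [← h4.tsum_eq]
    exact tsum_congr fun i => by simp [hdef]
  have hpoly : ∀ G : ℕ → ℂ → ℂ, (∀ j, DifferentiableOn ℂ (G j) B) →
      (fun z => ∑ j ∈ Finset.range (n + 1), z ^ j * conj (G j z)) ∈ antiPoly B n := by
    intro G hG
    have h1 := Submodule.sum_mem (antiPoly B n) (t := Finset.range (n + 1))
      fun j hj => monomial_mem_antiPoly (Nat.lt_succ_iff.1 (Finset.mem_range.1 hj)) (hG j)
    convert h1 using 1
    ext z
    simp
  refine ⟨fun z hz => ?_, fun z hz => ?_, fun z hz => ?_⟩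
  · have h1 := (analyticAt_of_antiPoly hBo (hpoly Φ hΦd) hz).add
      ((hHd.analyticAt (hBo.mem_nhds hz)).restrictScalars (𝕜 := ℝ))
    exact h1.congr (Set.EqOn.eventuallyEq_of_mem (s := B)
      (fun z hz => (hsum z hz).symm) (hBo.mem_nhds hz))
  · have h1 := (HasWirtinger.sum (Finset.range (n + 1)) fun j _ =>
      (HasWirtinger.of_hasDerivAt (hasDerivAt_pow j z)).mul
        (HasWirtinger.of_hasDerivAt (hΦ' j z hz)).conjugate).add
      (HasWirtinger.of_hasDerivAt (hasDerivAt_of_differentiableOn hBo hHd hz))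
    refine ⟨_, (h1.of_eq rfl ?_).congr_of_eventuallyEq
      (Set.EqOn.eventuallyEq_of_mem (s := B) hsum (hBo.mem_nhds hz))⟩
    simp only [mul_zero, add_zero, sum_imPowCoeff]
  · rw [wz_iterate_of_antiPoly hBo (hpoly Φ hΦd) hHd hsum hz]
    have h1 := hasSum_iterate_deriv hBo (n + 1) hvsum hh hhu hz
    refine h1.congr_fun fun i => ?_
    exact wz_iterate_of_antiPoly hBo (hpoly (F i) (hFd i)) (hh i)
      (fun z hz => by simp) hz

/-! ### The integrals of even powers of the hyperbolic sine -/

/-- `∫_0^t sinh^{2n}(θ) dθ`. -/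
def sinhInt (n : ℕ) (t : ℝ) : ℝ := ∫ θ in (0 : ℝ)..t, Real.sinh θ ^ (2 * n)

theorem hasDerivAt_sinhInt (n : ℕ) (t : ℝ) :
    HasDerivAt (sinhInt n) (Real.sinh t ^ (2 * n)) t :=
  ((Real.continuous_sinh.pow _).integral_hasStrictDerivAt 0 t).hasDerivAt

theorem sinhInt_zero (t : ℝ) : sinhInt 0 t = t := by simp [sinhInt]

theorem sinhInt_succ (n : ℕ) (t : ℝ) :
    (2 * n + 2) * sinhInt (n + 1) t =
      Real.sinh t ^ (2 * n + 1) * Real.cosh t - (2 * n + 1) * sinhInt n t := by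
  have hd : ∀ t, HasDerivAt (fun t => (2 * n + 2) * sinhInt (n + 1) t -
      (Real.sinh t ^ (2 * n + 1) * Real.cosh t - (2 * n + 1) * sinhInt n t)) 0 t := by
    intro t
    have h1 := (((hasDerivAt_sinhInt (n + 1) t).const_mul (2 * n + 2 : ℝ)).sub
      ((((Real.hasDerivAt_sinh t).pow (2 * n + 1)).mul (Real.hasDerivAt_cosh t)).sub
      ((hasDerivAt_sinhInt n t).const_mul (2 * n + 1 : ℝ))))
    refine h1.congr_deriv ?_
    simp only [Pi.pow_apply, Nat.add_sub_cancel]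
    push_cast
    linear_combination (2 * (n : ℝ) + 1) * Real.sinh t ^ (2 * n) * -Real.cosh_sq t
  have h := is_const_of_deriv_eq_zero (fun t => (hd t).differentiableAt) (fun t => (hd t).deriv) t 0
  simp [sinhInt] at h
  simp only [sinhInt]
  linarith

theorem sinhInt_nonneg (n : ℕ) {t : ℝ} (ht : 0 ≤ t) : 0 ≤ sinhInt n t :=
  intervalIntegral.integral_nonneg ht fun _ hθ => pow_nonneg (Real.sinh_nonneg_iff.2 hθ.1) _

theorem sinhInt_le (n : ℕ) {t : ℝ} (ht : 0 ≤ t) :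
    sinhInt n t ≤ Real.sinh t ^ (2 * n + 1) / (2 * n + 1) := by
  have hd : ∀ x ∈ Set.uIcc 0 t, HasDerivAt (fun t => Real.sinh t ^ (2 * n + 1) / (2 * n + 1))
      (Real.sinh x ^ (2 * n) * Real.cosh x) x := by
    intro x _
    refine (((Real.hasDerivAt_sinh x).pow (2 * n + 1)).div_const (2 * n + 1 : ℝ)).congr_deriv ?_
    simp only [Nat.add_sub_cancel]
    push_cast
    field_simp
  have hc : Continuous fun x => Real.sinh x ^ (2 * n) * Real.cosh x := by fun_prop
  have h := intervalIntegral.integral_eq_sub_of_hasDerivAt hd (hc.intervalIntegrable _ _)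
  simp only [Real.sinh_zero, ne_eq, Nat.add_eq_zero_iff, one_ne_zero, and_false,
    not_false_eq_true, zero_pow, zero_div, sub_zero] at h
  rw [← h]
  refine intervalIntegral.integral_mono_on ht
    ((Real.continuous_sinh.pow _).intervalIntegrable _ _) (hc.intervalIntegrable _ _) fun x hx => ?_
  exact le_mul_of_one_le_right (pow_nonneg (Real.sinh_nonneg_iff.2 hx.1) _) (Real.one_le_cosh x)

/-- `sinh²ⁿ` grows no faster than its integral, because `cosh ≤ sinh + 1` on `[0, ∞)`. -/
theorem sinh_pow_le_sinhInt {n : ℕ} (hn : 1 ≤ n) {t : ℝ} (ht : 0 ≤ t) :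
    Real.sinh t ^ (2 * n) ≤ 4 * n * sinhInt n t + 2 * n * Real.sinh t := by
  obtain ⟨m, rfl⟩ : ∃ m, n = m + 1 := ⟨n - 1, by omega⟩
  have hd : ∀ x ∈ Set.uIcc 0 t, HasDerivAt (fun t => Real.sinh t ^ (2 * (m + 1)))
      ((2 * (m + 1)) * Real.sinh x ^ (2 * m + 1) * Real.cosh x) x := by
    intro x _
    refine ((Real.hasDerivAt_sinh x).pow (2 * (m + 1))).congr_deriv ?_
    rw [show 2 * (m + 1) - 1 = 2 * m + 1 by omega]
    push_cast
    ring
  have hc : Continuous fun x => (2 * (m + 1 : ℝ)) * Real.sinh x ^ (2 * m + 1) * Real.cosh x := by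
    fun_prop
  have hc' : Continuous fun x => 4 * (m + 1 : ℝ) * Real.sinh x ^ (2 * (m + 1)) + 2 * (m + 1) := by
    fun_prop
  have hc'' : Continuous fun x => 4 * (m + 1 : ℝ) * Real.sinh x ^ (2 * (m + 1)) := by fun_prop
  have h := intervalIntegral.integral_eq_sub_of_hasDerivAt hd (hc.intervalIntegrable _ _)
  simp only [Real.sinh_zero, ne_eq, mul_eq_zero, Nat.add_eq_zero_iff, one_ne_zero, and_false,
    not_false_eq_true, zero_pow, sub_zero, OfNat.ofNat_ne_zero, or_self] at h
  have h2 : ∫ x in (0 : ℝ)..t, (4 * (m + 1 : ℝ) * Real.sinh x ^ (2 * (m + 1)) + 2 * (m + 1)) =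
      4 * (m + 1) * sinhInt (m + 1) t + 2 * (m + 1) * t := by
    rw [intervalIntegral.integral_add (hc''.intervalIntegrable _ _) (by simp),
      intervalIntegral.integral_const_mul, sinhInt]
    simp
    ring
  have h3 : (2 : ℝ) * (m + 1) * t ≤ 2 * (m + 1) * Real.sinh t :=
    mul_le_mul_of_nonneg_left (Real.self_le_sinh_iff.2 ht) (by positivity)
  push_cast
  refine le_trans ?_ (add_le_add_right h3 _)
  rw [← h, ← h2]
  refine intervalIntegral.integral_mono_on ht (hc.intervalIntegrable _ _)
    (hc'.intervalIntegrable _ _) fun x hx => ?_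
  have hs : 0 ≤ Real.sinh x := Real.sinh_nonneg_iff.2 hx.1
  have hcosh : Real.cosh x ≤ Real.sinh x + 1 := by
    have h5 := Real.cosh_sub_sinh x
    have h6 : Real.exp (-x) ≤ 1 := Real.exp_le_one_iff.2 (by linarith [hx.1])
    linarith
  set σ := Real.sinh x
  have h7 : σ ^ (2 * m + 1) ≤ σ ^ (2 * (m + 1)) + 1 := by
    rcases le_total σ 1 with h8 | h8
    · have := pow_le_one₀ hs h8 (n := 2 * m + 1)
      have := pow_nonneg hs (2 * (m + 1))
      linarith
    · have := pow_le_pow_right₀ h8 (show 2 * m + 1 ≤ 2 * (m + 1) by omega)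
      linarith
  have h8 : σ ^ (2 * m + 1) * Real.cosh x ≤ 2 * σ ^ (2 * (m + 1)) + 1 :=
    calc σ ^ (2 * m + 1) * Real.cosh x ≤ σ ^ (2 * m + 1) * (σ + 1) :=
          mul_le_mul_of_nonneg_left hcosh (pow_nonneg hs _)
      _ = σ ^ (2 * (m + 1)) + σ ^ (2 * m + 1) := by ring
      _ ≤ _ := by linarith
  have h9 : (0 : ℝ) ≤ 2 * (m + 1) := by positivity
  nlinarith [mul_le_mul_of_nonneg_left h8 h9]

/-! ### The summands as functions on the complex plane -/

namespace IntBQF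

/-- The hermitian form `a |z|² + b x + c`, so that `Q_z = y⁻¹ (a |z|² + b x + c)`. -/
def herm (Q : IntBQF) (z : ℂ) : ℝ := (Q.a : ℝ) * ‖z‖ ^ 2 + (Q.b : ℝ) * z.re + (Q.c : ℝ)

/-- `artanh (√D / Q_z)`, as a function on `ℂ`. -/
def angle (Q : IntBQF) (z : ℂ) : ℝ := Real.artanh (√Q.absDisc * z.im / Q.herm z)

/-- `Q(z, 1)^n ∫_0^{artanh (√D / Q_z)} sinh^{2n}(θ) dθ`, as a function on `ℂ`. -/
def term (n : ℕ) (Q : IntBQF) (z : ℂ) : ℂ := Q.eval z 1 ^ n * (sinhInt n (Q.angle z) : ℂ)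

variable {Q : IntBQF} {z : ℂ}

theorem eval_one (Q : IntBQF) (z : ℂ) : Q.eval z 1 = Q.a * z ^ 2 + Q.b * z + Q.c := by
  simp [eval]

theorem absDisc_eq (Q : IntBQF) : Q.absDisc = 4 * Q.a * Q.c - (Q.b : ℝ) ^ 2 := by
  simp only [absDisc, disc]
  push_cast
  ring

theorem herm_eq (Q : IntBQF) (z : ℂ) :
    Q.herm z = Q.a * (z.re ^ 2 + z.im ^ 2) + Q.b * z.re + Q.c := by
  rw [herm, Complex.sq_norm, Complex.normSq_apply]
  ring

/-- The identity `|Q(z, 1)|² = y² (Q_z² - D)`. -/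
theorem sq_norm_eval (Q : IntBQF) (z : ℂ) :
    ‖Q.eval z 1‖ ^ 2 = Q.herm z ^ 2 - Q.absDisc * z.im ^ 2 := by
  rw [Complex.sq_norm, Complex.normSq_apply, herm_eq, absDisc_eq, eval_one]
  simp [pow_two]
  ring

theorem herm_pos (hQ : Q.PosDef) (z : ℂ) : 0 < Q.herm z := by
  have ha := hQ.a_pos
  have hD := hQ.absDisc_pos
  have h : 4 * Q.a * Q.herm z =
      (2 * Q.a * z.re + Q.b) ^ 2 + (2 * Q.a * z.im) ^ 2 + Q.absDisc := by
    rw [herm_eq, absDisc_eq]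
    ring
  have h2 : 0 < 4 * Q.a * Q.herm z := by
    rw [h]
    positivity
  exact (mul_pos_iff_of_pos_left (by positivity)).1 h2

theorem sqrt_mul_im_lt_herm (hQ : Q.PosDef) (hq : Q.eval z 1 ≠ 0) :
    √Q.absDisc * z.im < Q.herm z := by
  have h1 : 0 < ‖Q.eval z 1‖ ^ 2 := by positivity
  rw [sq_norm_eval] at h1
  refine lt_of_pow_lt_pow_left₀ 2 (herm_pos hQ z).le ?_
  rw [mul_pow, Real.sq_sqrt hQ.absDisc_pos.le]
  linarith

theorem ratio_mem (hQ : Q.PosDef) (hz : 0 < z.im) (hq : Q.eval z 1 ≠ 0) :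
    √Q.absDisc * z.im / Q.herm z ∈ Set.Ioo 0 1 := by
  have h1 := herm_pos hQ z
  have h2 := Real.sqrt_pos.2 hQ.absDisc_pos
  exact ⟨by positivity, (div_lt_one h1).2 (sqrt_mul_im_lt_herm hQ hq)⟩

theorem angle_nonneg (hQ : Q.PosDef) (hz : 0 < z.im) : 0 ≤ Q.angle z :=
  Real.artanh_nonneg (div_nonneg (mul_nonneg (Real.sqrt_nonneg _) hz.le) (herm_pos hQ z).le)

theorem angle_eq_log (hQ : Q.PosDef) (hz : 0 < z.im) (hq : Q.eval z 1 ≠ 0) :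
    Q.angle z = 1 / 2 * (Real.log (Q.herm z + √Q.absDisc * z.im) -
      Real.log (Q.herm z - √Q.absDisc * z.im)) := by
  have h1 := herm_pos hQ z
  have h2 := ratio_mem hQ hz hq
  have h3 := sqrt_mul_im_lt_herm hQ hq
  have h4 : 0 ≤ √Q.absDisc * z.im := mul_nonneg (Real.sqrt_nonneg _) hz.le
  rw [angle, Real.artanh_eq_half_log ⟨by linarith [h2.1], h2.2.le⟩, ← Real.log_div
    (by linarith) (by linarith)]
  congr 2
  have : Q.herm z - √Q.absDisc * z.im ≠ 0 := by linarith
  field_simp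

theorem one_sub_ratio_sq (hQ : Q.PosDef) :
    1 - (√Q.absDisc * z.im / Q.herm z) ^ 2 = ‖Q.eval z 1‖ ^ 2 / Q.herm z ^ 2 := by
  have h1 := (herm_pos hQ z).ne'
  rw [sq_norm_eval, div_pow, mul_pow, Real.sq_sqrt hQ.absDisc_pos.le]
  field_simp

theorem sqrt_one_sub_ratio_sq (hQ : Q.PosDef) :
    √(1 - (√Q.absDisc * z.im / Q.herm z) ^ 2) = ‖Q.eval z 1‖ / Q.herm z := by
  have h1 := herm_pos hQ z
  rw [one_sub_ratio_sq hQ, ← div_pow, Real.sqrt_sq (by positivity)]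

theorem sinh_angle (hQ : Q.PosDef) (hz : 0 < z.im) (hq : Q.eval z 1 ≠ 0) :
    Real.sinh (Q.angle z) = √Q.absDisc * z.im / ‖Q.eval z 1‖ := by
  have h1 := (herm_pos hQ z).ne'
  have h2 := ratio_mem hQ hz hq
  have h3 := norm_ne_zero_iff.2 hq
  rw [angle, Real.sinh_artanh ⟨by linarith [h2.1], h2.2⟩, sqrt_one_sub_ratio_sq hQ]
  field_simp

theorem cosh_angle (hQ : Q.PosDef) (hz : 0 < z.im) (hq : Q.eval z 1 ≠ 0) :
    Real.cosh (Q.angle z) = Q.herm z / ‖Q.eval z 1‖ := by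
  have h2 := ratio_mem hQ hz hq
  rw [angle, Real.cosh_artanh ⟨by linarith [h2.1], h2.2⟩, sqrt_one_sub_ratio_sq hQ, one_div_div]

theorem norm_term_le (n : ℕ) (hQ : Q.PosDef) (hz : 0 < z.im) (hq : Q.eval z 1 ≠ 0) :
    ‖term n Q z‖ ≤ (√Q.absDisc * z.im) ^ (2 * n + 1) * (‖Q.eval z 1‖ ^ (n + 1))⁻¹ := by
  have h0 := angle_nonneg hQ hz
  have h1 := sinhInt_le n h0
  have h3 : 0 < ‖Q.eval z 1‖ := norm_pos_iff.2 hq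
  have h4 : 0 ≤ √Q.absDisc * z.im := mul_nonneg (Real.sqrt_nonneg _) hz.le
  rw [sinh_angle hQ hz hq] at h1
  have h5 : (√Q.absDisc * z.im / ‖Q.eval z 1‖) ^ (2 * n + 1) / (2 * n + 1) ≤
      (√Q.absDisc * z.im / ‖Q.eval z 1‖) ^ (2 * n + 1) := by
    apply div_le_self (by positivity)
    have : (0 : ℝ) ≤ n := n.cast_nonneg
    linarith
  rw [term, norm_mul, norm_pow, Complex.norm_real, Real.norm_of_nonneg (sinhInt_nonneg n h0)]
  calc _ ≤ ‖Q.eval z 1‖ ^ n * (√Q.absDisc * z.im / ‖Q.eval z 1‖) ^ (2 * n + 1) := by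
        gcongr
        exact h1.trans h5
    _ = _ := by
        rw [div_pow]
        field_simp
        ring

/-- Near a zero of `Q(z, 1)` the summand blows up like `|Q(z, 1)|⁻ⁿ`. -/
theorem le_norm_term {n : ℕ} (hn : 1 ≤ n) (hQ : Q.PosDef) (hz : 0 < z.im)
    (hq : Q.eval z 1 ≠ 0) :
    (√Q.absDisc * z.im) ^ (2 * n) ≤ 4 * n * ‖term n Q z‖ * ‖Q.eval z 1‖ ^ n +
      2 * n * (√Q.absDisc * z.im) * ‖Q.eval z 1‖ ^ (2 * n - 1) := by
  have h0 := angle_nonneg hQ hz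
  have h1 := sinh_pow_le_sinhInt hn h0
  have h3 : 0 < ‖Q.eval z 1‖ := norm_pos_iff.2 hq
  rw [sinh_angle hQ hz hq] at h1
  rw [term, norm_mul, norm_pow, Complex.norm_real, Real.norm_of_nonneg (sinhInt_nonneg n h0)]
  have h4 := mul_le_mul_of_nonneg_right h1 (pow_nonneg h3.le (2 * n))
  rw [div_pow, div_mul_cancel₀ _ (by positivity)] at h4
  refine h4.trans_eq ?_
  obtain ⟨m, rfl⟩ : ∃ m, n = m + 1 := ⟨n - 1, by omega⟩
  rw [show 2 * (m + 1) - 1 = 2 * m + 1 by omega]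
  field_simp
  ring

/-! ### Wirtinger derivatives of the summands -/

theorem hasWirtinger_herm (Q : IntBQF) (z : ℂ) :
    HasWirtinger (fun z => (Q.herm z : ℂ)) (Q.a * conj z + Q.b / 2) (Q.a * z + Q.b / 2) z := by
  have h1 := HasWirtinger.of_hasDerivAt (hasDerivAt_id z)
  have h2 := (((h1.mul h1.conjugate).const_mul (Q.a : ℂ)).add
    (HasWirtinger.re.const_mul (Q.b : ℂ))).add (HasWirtinger.const (Q.c : ℂ))
  refine (h2.of_eq ?_ ?_).congr_of_eventuallyEq (Filter.Eventually.of_forall fun w => ?_)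
  · simp; ring
  · simp; ring
  · simp only [herm, id]
    push_cast
    rw [Complex.mul_conj, Complex.normSq_eq_norm_sq]
    push_cast
    ring

theorem hasDerivAt_eval (Q : IntBQF) (z : ℂ) :
    HasDerivAt (fun z : ℂ => Q.eval z 1) (2 * Q.a * z + Q.b) z := by
  have h := (((hasDerivAt_pow 2 z).const_mul (Q.a : ℂ)).add
    ((hasDerivAt_id z).const_mul (Q.b : ℂ))).add_const (Q.c : ℂ)
  refine (h.congr_deriv ?_).congr_of_eventuallyEq (Filter.Eventually.of_forall fun w => ?_)
  · simp; ring
  · simp [eval_one]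

theorem differentiable_eval (Q : IntBQF) : Differentiable ℂ fun z : ℂ => Q.eval z 1 :=
  fun z => (hasDerivAt_eval Q z).differentiableAt

theorem sqrt_absDisc_sq (hQ : Q.PosDef) : (√Q.absDisc : ℂ) ^ 2 = Q.absDisc := by
  rw [← Complex.ofReal_pow, Real.sq_sqrt hQ.absDisc_pos.le]

theorem eval_mul_conj (Q : IntBQF) (z : ℂ) :
    Q.eval z 1 * conj (Q.eval z 1) = (Q.herm z : ℂ) ^ 2 - Q.absDisc * (z.im : ℂ) ^ 2 := by
  rw [Complex.mul_conj, Complex.normSq_eq_norm_sq, sq_norm_eval]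
  push_cast
  ring

theorem im_eq (z : ℂ) : (z.im : ℂ) = -Complex.I / 2 * (z - conj z) := by
  rw [Complex.sub_conj]
  push_cast
  linear_combination (z.im : ℂ) * Complex.I_mul_I

theorem herm_eq_conj (Q : IntBQF) (z : ℂ) :
    (Q.herm z : ℂ) = Q.a * (z * conj z) + Q.b / 2 * (z + conj z) + Q.c := by
  rw [herm, Complex.mul_conj, Complex.normSq_eq_norm_sq, Complex.add_conj]
  push_cast
  ring

theorem hasWirtinger_angle (hQ : Q.PosDef) (hz : 0 < z.im) (hq : Q.eval z 1 ≠ 0) :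
    HasWirtinger (fun z => (Q.angle z : ℂ)) (-Complex.I * √Q.absDisc / 2 * (Q.eval z 1)⁻¹)
      (Complex.I * √Q.absDisc / 2 * conj (Q.eval z 1)⁻¹) z := by
  have h3 := sqrt_mul_im_lt_herm hQ hq
  have h4 : 0 ≤ √Q.absDisc * z.im := mul_nonneg (Real.sqrt_nonneg _) hz.le
  have hN := hasWirtinger_herm Q z
  have hy := HasWirtinger.im (z := z) |>.const_mul (√Q.absDisc : ℂ)
  have h5 := hN.add hy
  have h6 := hN.sub hy
  have p5 : 0 < Q.herm z + √Q.absDisc * z.im := by linarith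
  have p6 : 0 < Q.herm z - √Q.absDisc * z.im := by linarith
  have l5 := HasWirtinger.real_comp (u := fun z => Q.herm z + √Q.absDisc * z.im)
    (h5.congr_of_eventuallyEq (Filter.Eventually.of_forall fun w => by push_cast; rfl))
    (Real.hasDerivAt_log p5.ne')
  have l6 := HasWirtinger.real_comp (u := fun z => Q.herm z - √Q.absDisc * z.im)
    (h6.congr_of_eventuallyEq (Filter.Eventually.of_forall fun w => by push_cast; rfl))
    (Real.hasDerivAt_log p6.ne')
  have h7 := (l5.sub l6).const_mul (1 / 2)
  have hne : ((Q.herm z : ℂ) + √Q.absDisc * z.im) ≠ 0 := by exact_mod_cast p5.ne'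
  have hne' : ((Q.herm z : ℂ) - √Q.absDisc * z.im) ≠ 0 := by exact_mod_cast p6.ne'
  have hq' : conj (Q.eval z 1) ≠ 0 := by simpa using hq
  have hs := sqrt_absDisc_sq hQ
  have hprod : ((Q.herm z : ℂ) + √Q.absDisc * z.im) * ((Q.herm z : ℂ) - √Q.absDisc * z.im) =
      Q.eval z 1 * conj (Q.eval z 1) := by
    rw [eval_mul_conj]
    linear_combination -(z.im : ℂ) ^ 2 * hs
  have hcq : conj (Q.eval z 1) = Q.a * conj z ^ 2 + Q.b * conj z + Q.c := by
    rw [eval_one]; simp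
  have hquot : ∀ P M : ℂ, ((Q.herm z : ℂ) + √Q.absDisc * z.im)⁻¹ * P -
      ((Q.herm z : ℂ) - √Q.absDisc * z.im)⁻¹ * M =
      (P * ((Q.herm z : ℂ) - √Q.absDisc * z.im) - M * ((Q.herm z : ℂ) + √Q.absDisc * z.im)) /
      (((Q.herm z : ℂ) + √Q.absDisc * z.im) * ((Q.herm z : ℂ) - √Q.absDisc * z.im)) := by
    intro P M
    field_simp
  refine (h7.of_eq ?_ ?_).congr_of_eventuallyEq ?_
  · have hI : 1 / (2 * Complex.I) = -Complex.I / 2 := by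
      field_simp
      simp
    push_cast
    rw [hquot, hprod, hI, herm_eq_conj, im_eq]
    field_simp
    rw [hcq]
    ring
  · have hI : -1 / (2 * Complex.I) = Complex.I / 2 := by
      field_simp
      simp
    push_cast
    rw [hquot, hprod, hI, herm_eq_conj, im_eq, map_inv₀]
    field_simp
    rw [eval_one]
    ring
  · have ho : ∀ᶠ w : ℂ in 𝓝 z, 0 < w.im ∧ Q.eval w 1 ≠ 0 :=
      (continuousAt_const.eventually_lt Complex.continuous_im.continuousAt hz).and
        ((differentiable_eval Q).continuous.continuousAt.eventually_ne hq)
    filter_upwards [ho] with w hw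
    rw [angle_eq_log hQ hw.1 hw.2]
    push_cast
    ring

theorem hasWirtinger_term (n : ℕ) (hQ : Q.PosDef) (hz : 0 < z.im) (hq : Q.eval z 1 ≠ 0) :
    ∃ A, HasWirtinger (term n Q) A (Complex.I * √Q.absDisc / 2 * (Q.absDisc : ℂ) ^ n *
      (z.im : ℂ) ^ (2 * n) * conj ((Q.eval z 1 ^ (n + 1))⁻¹)) z := by
  have h1 := (hasWirtinger_angle hQ hz hq).real_comp (hasDerivAt_sinhInt n (Q.angle z))
  have h2 := (HasWirtinger.of_hasDerivAt ((hasDerivAt_eval Q z).fun_pow n)).mul h1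
  refine ⟨_, h2.of_eq rfl ?_⟩
  have hq' : conj (Q.eval z 1) ≠ 0 := by simpa using hq
  have hsq : ((Real.sinh (Q.angle z) : ℝ) : ℂ) ^ 2 =
      Q.absDisc * (z.im : ℂ) ^ 2 * (Q.eval z 1 * conj (Q.eval z 1))⁻¹ := by
    rw [sinh_angle hQ hz hq, Complex.mul_conj, Complex.normSq_eq_norm_sq, ← sqrt_absDisc_sq hQ]
    push_cast
    ring
  simp only [mul_zero, add_zero, Complex.ofReal_pow]
  rw [pow_mul, hsq, map_inv₀, map_inv₀, map_pow, mul_inv, mul_pow, mul_pow, mul_pow, inv_pow,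
    inv_pow, ← pow_mul]
  field_simp
  ring

end IntBQF

/-! ### The iterated derivative of a summand -/

namespace IntBQF

variable {Q : IntBQF}

/-- Leibniz rule for the product with the quadratic polynomial `Q(z, 1)`. -/
theorem iterate_deriv_eval_mul (Q : IntBQF) {U : Set ℂ} (hU : IsOpen U) {H : ℂ → ℂ}
    (hH : DifferentiableOn ℂ H U) (m : ℕ) :
    Set.EqOn (deriv^[m + 2] fun z => Q.eval z 1 * H z)
      (fun z => Q.eval z 1 * deriv^[m + 2] H z +
        (m + 2) * (2 * Q.a * z + Q.b) * deriv^[m + 1] H z +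
        (m + 2) * (m + 1) * Q.a * deriv^[m] H z) U := by
  have hd : ∀ i, ∀ z ∈ U, HasDerivAt (deriv^[i] H) (deriv^[i + 1] H z) z := by
    intro i z hz
    rw [Function.iterate_succ_apply']
    exact hasDerivAt_of_differentiableOn hU (differentiableOn_iterate_deriv hU hH i) hz
  have hl : ∀ z : ℂ, HasDerivAt (fun z : ℂ => 2 * (Q.a : ℂ) * z + Q.b) (2 * Q.a) z := by
    intro z
    simpa using ((hasDerivAt_id z).const_mul (2 * (Q.a : ℂ))).add_const (Q.b : ℂ)
  induction m with
  | zero =>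
    have h1 : Set.EqOn (deriv fun z => Q.eval z 1 * H z)
        (fun z => (2 * Q.a * z + Q.b) * H z + Q.eval z 1 * deriv H z) U :=
      fun z hz => ((hasDerivAt_eval Q z).mul (hd 0 z hz)).deriv
    intro z hz
    have h2 := ((hl z).mul (hd 0 z hz)).add ((hasDerivAt_eval Q z).mul (hd 1 z hz))
    have h3 := (h1.eventuallyEq_of_mem (hU.mem_nhds hz)).deriv_eq.trans h2.deriv
    refine h3.trans ?_
    simp
    ring
  | succ m ih =>
    intro z hz
    rw [Function.iterate_succ_apply', (ih.eventuallyEq_of_mem (hU.mem_nhds hz)).deriv_eq]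
    have h2 := (((hasDerivAt_eval Q z).mul (hd (m + 2) z hz)).add
      (((hl z).const_mul (m + 2 : ℂ)).mul (hd (m + 1) z hz))).add
      ((hd m z hz).const_mul ((m + 2) * (m + 1) * Q.a : ℂ))
    refine h2.deriv.trans ?_
    push_cast
    ring

theorem hasDerivAt_inv_eval_pow (Q : IntBQF) (n : ℕ) {z : ℂ} (hq : Q.eval z 1 ≠ 0) :
    HasDerivAt (fun z : ℂ => (Q.eval z 1 ^ n)⁻¹)
      (-n * (2 * Q.a * z + Q.b) * (Q.eval z 1 ^ (n + 1))⁻¹) z := by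
  refine (((hasDerivAt_eval Q z).fun_pow n).fun_inv (pow_ne_zero n hq)).congr_deriv ?_
  rcases n with _ | n
  · simp
  · rw [Nat.add_sub_cancel]
    field_simp
    ring

/-- A case of Bol's identity: if `ℓ' = κ / q` with `q = Q(z, 1)`, then the derivative of order
`2n + 1` of `qⁿ ℓ` is a multiple of `q⁻ⁿ⁻¹`. -/
theorem iterate_deriv_eval_pow_mul (Q : IntBQF) {U : Set ℂ} (hU : IsOpen U)
    (hq : ∀ z ∈ U, Q.eval z 1 ≠ 0) {ℓ : ℂ → ℂ} {κ : ℂ}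
    (hℓ : ∀ z ∈ U, HasDerivAt ℓ (κ * (Q.eval z 1)⁻¹) z) (n : ℕ) :
    Set.EqOn (deriv^[2 * n + 1] fun z => Q.eval z 1 ^ n * ℓ z)
      (fun z => (Q.absDisc : ℂ) ^ n * (n.factorial : ℂ) ^ 2 * κ * (Q.eval z 1 ^ (n + 1))⁻¹) U := by
  have hℓd : DifferentiableOn ℂ ℓ U := fun z hz =>
    (hℓ z hz).differentiableAt.differentiableWithinAt
  induction n with
  | zero =>
    intro z hz
    simpa using (hℓ z hz).deriv
  | succ n ih =>
    set f : ℂ → ℂ := fun z => Q.eval z 1 ^ n * ℓ z with hf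
    have hfd : DifferentiableOn ℂ f U :=
      ((differentiable_eval Q).pow n).differentiableOn.mul hℓd
    set K : ℂ := (Q.absDisc : ℂ) ^ n * (n.factorial : ℂ) ^ 2 * κ with hK
    have h1 : Set.EqOn (deriv^[2 * n + 2] f) (fun z => K *
        (-(n + 1 : ℕ) * (2 * Q.a * z + Q.b) * (Q.eval z 1 ^ (n + 2))⁻¹)) U := by
      intro z hz
      rw [Function.iterate_succ_apply', (ih.eventuallyEq_of_mem (hU.mem_nhds hz)).deriv_eq]
      exact ((hasDerivAt_inv_eval_pow Q (n + 1) (hq z hz)).const_mul K).deriv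
    have h2 : Set.EqOn (deriv^[2 * n + 3] f) (fun z => K * (-(n + 1 : ℕ) *
        (2 * Q.a * (Q.eval z 1 ^ (n + 2))⁻¹ + (2 * Q.a * z + Q.b) *
          (-(n + 2 : ℕ) * (2 * Q.a * z + Q.b) * (Q.eval z 1 ^ (n + 3))⁻¹)))) U := by
      intro z hz
      rw [Function.iterate_succ_apply', (h1.eventuallyEq_of_mem (hU.mem_nhds hz)).deriv_eq]
      have hl : HasDerivAt (fun z : ℂ => 2 * (Q.a : ℂ) * z + Q.b) (2 * Q.a) z := by
        simpa using ((hasDerivAt_id z).const_mul (2 * (Q.a : ℂ))).add_const (Q.b : ℂ)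
      have h3 := ((hl.mul (hasDerivAt_inv_eval_pow Q (n + 2) (hq z hz))).const_mul
        (-((n + 1 : ℕ) : ℂ))).const_mul K
      refine Eq.trans ?_ h3.deriv
      congr 1
      ext w
      simp only [Pi.mul_apply]
      ring
    intro z hz
    have h4 : (fun z : ℂ => Q.eval z 1 ^ (n + 1) * ℓ z) = fun z => Q.eval z 1 * f z := by
      ext w
      simp only [hf]
      ring
    rw [h4]
    refine (iterate_deriv_eval_mul Q hU hfd (2 * n + 1) hz).trans ?_
    simp only
    rw [h2 hz, h1 hz, ih hz]
    beta_reduce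
    have hD : (Q.absDisc : ℂ) = 4 * Q.a * Q.c - (Q.b : ℂ) ^ 2 := by
      rw [absDisc_eq]
      push_cast
      ring
    have hc := eval_one Q z
    have hne := hq z hz
    -- the discriminant of `q` enters as `q'² - 4 a q = -D`
    have hq' : (2 * (Q.a : ℂ) * z + Q.b) ^ 2 = 4 * Q.a * Q.eval z 1 - Q.absDisc := by
      rw [hD, hc]
      ring
    have hfact : ((n + 1).factorial : ℂ) = (n + 1) * n.factorial := by
      rw [Nat.factorial_succ]
      push_cast
      ring
    rw [hfact, pow_succ (Q.absDisc : ℂ)]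
    generalize hL : 2 * (Q.a : ℂ) * z + Q.b = L at hq' ⊢
    generalize Q.eval z 1 = q at hne hq' ⊢
    have hDq : (Q.absDisc : ℂ) = 4 * Q.a * q - L ^ 2 := by rw [hq']; ring
    simp only [hK]
    rw [show (Q.absDisc : ℂ) ^ n * (Q.absDisc : ℂ) = (Q.absDisc : ℂ) ^ n * (4 * Q.a * q - L ^ 2) by
      rw [← hDq]]
    generalize (Q.absDisc : ℂ) ^ n = E
    push_cast
    field_simp
    ring

theorem im_mem_antiPoly (U : Set ℂ) : (fun z : ℂ => (z.im : ℂ)) ∈ antiPoly U 1 := by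
  have h1 := pow_mem_antiPoly (U := U) (d := 1) (j := 1) le_rfl
  have h2 := conj_mem_antiPoly (U := U) (d := 1) differentiableOn_id
  convert Submodule.smul_mem _ (-Complex.I / 2) (Submodule.sub_mem _ h1 h2) using 1
  ext z
  simpa using im_eq z

theorem herm_mem_antiPoly (Q : IntBQF) (U : Set ℂ) :
    (fun z : ℂ => (Q.herm z : ℂ)) ∈ antiPoly U 1 := by
  have h1 := pow_mem_antiPoly (U := U) (d := 1) (j := 1) le_rfl
  have h2 := conj_mem_antiPoly (U := U) (d := 1) differentiableOn_id
  have h3 := monomial_mem_antiPoly (U := U) (d := 1) (j := 1) le_rfl differentiableOn_id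
  have h4 := pow_mem_antiPoly (U := U) (d := 1) (j := 0) zero_le_one
  convert Submodule.add_mem _ (Submodule.add_mem _ (Submodule.smul_mem _ (Q.a : ℂ) h3)
    (Submodule.smul_mem _ (Q.b / 2 : ℂ) (Submodule.add_mem _ h1 h2)))
    (Submodule.smul_mem _ (Q.c : ℂ) h4) using 1
  ext z
  simpa [mul_add] using herm_eq_conj Q z

theorem eval_mem_antiPoly (Q : IntBQF) (U : Set ℂ) :
    (fun z : ℂ => Q.eval z 1) ∈ antiPoly U 2 := by
  have h (j : ℕ) (hj : j ≤ 2) := pow_mem_antiPoly (U := U) hj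
  convert Submodule.add_mem _ (Submodule.add_mem _ (Submodule.smul_mem _ (Q.a : ℂ) (h 2 le_rfl))
    (Submodule.smul_mem _ (Q.b : ℂ) (h 1 one_le_two)))
    (Submodule.smul_mem _ (Q.c : ℂ) (h 0 zero_le_two)) using 1
  ext z
  simpa using eval_one Q z

theorem eval_pow_mul_sinh (hQ : Q.PosDef) (n : ℕ) {z : ℂ} (hz : 0 < z.im) (hq : Q.eval z 1 ≠ 0) :
    Q.eval z 1 ^ (n + 1) * ((Real.sinh (Q.angle z) ^ (2 * n + 1) * Real.cosh (Q.angle z) : ℝ) : ℂ) =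
      √Q.absDisc * (Q.absDisc : ℂ) ^ n *
        ((z.im : ℂ) ^ (2 * n + 1) * Q.herm z * conj ((Q.eval z 1 ^ (n + 1))⁻¹)) := by
  have hq' : conj (Q.eval z 1) ≠ 0 := by simpa using hq
  have h1 : ((‖Q.eval z 1‖ : ℝ) : ℂ) ^ 2 = Q.eval z 1 * conj (Q.eval z 1) := by
    rw [Complex.mul_conj, Complex.normSq_eq_norm_sq]
    push_cast
    rfl
  have h2 : ((‖Q.eval z 1‖ : ℝ) : ℂ) ≠ 0 := by simpa using hq
  have h3 : (√Q.absDisc : ℂ) ^ (2 * n + 1) = √Q.absDisc * (Q.absDisc : ℂ) ^ n := by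
    rw [pow_succ, pow_mul, sqrt_absDisc_sq hQ]
    ring
  rw [sinh_angle hQ hz hq, cosh_angle hQ hz hq, ← h3]
  push_cast
  have h4 : (√Q.absDisc * z.im / (‖Q.eval z 1‖ : ℝ) : ℂ) ^ (2 * n + 1) *
      (Q.herm z / (‖Q.eval z 1‖ : ℝ)) = (√Q.absDisc : ℂ) ^ (2 * n + 1) * (z.im : ℂ) ^ (2 * n + 1) *
      Q.herm z * ((Q.eval z 1 * conj (Q.eval z 1)) ^ (n + 1))⁻¹ := by
    rw [← h1, ← pow_mul, div_pow, mul_pow]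
    field_simp
    ring
  rw [h4, map_inv₀, map_pow, mul_pow, mul_inv]
  field_simp

/-- The coefficient of `qⁿ ℓ` in the holomorphic part of a summand, where `ℓ` is the holomorphic
part of the angle. -/
def termCoeff (n : ℕ) : ℂ := (-1) ^ n * (2 * n).factorial / (4 ^ n * (n.factorial : ℂ) ^ 2)

theorem termCoeff_succ (n : ℕ) :
    termCoeff (n + 1) = -((2 * n + 1) / (2 * n + 2)) * termCoeff n := by
  have h1 : (n.factorial : ℂ) ≠ 0 := by exact_mod_cast n.factorial_ne_zero
  have h2 : (n : ℂ) + 1 ≠ 0 := by exact_mod_cast n.succ_ne_zero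
  simp only [termCoeff]
  rw [show 2 * (n + 1) = 2 * n + 1 + 1 by ring, Nat.factorial_succ (2 * n + 1),
    Nat.factorial_succ (2 * n), Nat.factorial_succ n]
  have h3 : (2 * (n : ℂ) + 2) = 2 * (n + 1) := by ring
  rw [h3]
  push_cast
  field_simp
  ring

/-- `∂^{2n+1}` maps a summand of `𝒢_Q` to a multiple of a summand of `f_Q`. Up to polynomials of
degree at most `2n` in `z`, the recursion for `∫ sinh^{2n}` reduces the summand to
`Q(z, 1)ⁿ` times the holomorphic part of the angle. -/
theorem wz_iterate_term (hQ : Q.PosDef) (n : ℕ) {z₀ : ℂ} {R : ℝ}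
    (hB : ∀ z ∈ ball z₀ R, 0 < z.im ∧ Q.eval z 1 ≠ 0) {z : ℂ} (hz : z ∈ ball z₀ R) :
    wz^[2 * n + 1] (term n Q) z = -Complex.I * √Q.absDisc / 2 * (-Q.absDisc : ℂ) ^ n *
      (2 * n).factorial / 4 ^ n * (Q.eval z 1 ^ (n + 1))⁻¹ := by
  set B := ball z₀ R with hBdef
  have hBo : IsOpen B := isOpen_ball
  have hinv : DifferentiableOn ℂ (fun z : ℂ => (Q.eval z 1)⁻¹) B :=
    (differentiable_eval Q).differentiableOn.inv fun z hz => (hB z hz).2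
  have hang : ∀ z ∈ B, HasWirtinger (fun z => (Q.angle z : ℂ))
      (-Complex.I * √Q.absDisc / 2 * (Q.eval z 1)⁻¹)
      (Complex.I * √Q.absDisc / 2 * conj (Q.eval z 1)⁻¹) z :=
    fun z hz => hasWirtinger_angle hQ (hB z hz).1 (hB z hz).2
  -- the angle is the sum of a holomorphic function `ℓ` and an antiholomorphic one
  obtain ⟨F, hF⟩ := hinv.isExactOn_ball
  set c : ℂ := Complex.I * √Q.absDisc / 2 with hc
  set ℓ : ℂ → ℂ := fun z => Q.angle z - conj (conj c * F z) with hℓdef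
  have hFd : DifferentiableOn ℂ (fun z => conj c * F z) B := fun z hz =>
    ((hF z hz).const_mul (conj c)).differentiableAt.differentiableWithinAt
  have hℓ : ∀ z ∈ B, HasDerivAt ℓ (-Complex.I * √Q.absDisc / 2 * (Q.eval z 1)⁻¹) z := by
    intro z hz
    have h1 := (hang z hz).sub
      (HasWirtinger.of_hasDerivAt ((hF z hz).const_mul (conj c))).conjugate
    exact (h1.of_eq (by simp) (by simp)).hasDerivAt
  have hℓd : DifferentiableOn ℂ ℓ B := fun z hz =>
    (hℓ z hz).differentiableAt.differentiableWithinAt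
  have hdecomp : ∀ n, ∃ p ∈ antiPoly B (2 * n), ∀ z ∈ B,
      term n Q z = p z + termCoeff n * (Q.eval z 1 ^ n * ℓ z) := by
    intro n
    induction n with
    | zero =>
      refine ⟨_, conj_mem_antiPoly hFd, fun z _ => ?_⟩
      simp [term, sinhInt_zero, termCoeff, hℓdef]
    | succ n ih =>
      obtain ⟨p, hp, hpe⟩ := ih
      have hpow : DifferentiableOn ℂ (fun z : ℂ => (Q.eval z 1 ^ (n + 1))⁻¹) B :=
        ((differentiable_eval Q).pow (n + 1)).differentiableOn.inv
          fun z hz => pow_ne_zero _ (hB z hz).2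
      have h1 := mul_mem_antiPoly (mul_mem_antiPoly
        (pow_fun_mem_antiPoly (im_mem_antiPoly B) (2 * n + 1)) (herm_mem_antiPoly Q B))
        (conj_mem_antiPoly (d := 0) hpow)
      have h2 := mul_mem_antiPoly (eval_mem_antiPoly Q B) hp
      have e1 : (2 * n + 1) * 1 + 1 + 0 = 2 * (n + 1) := by ring
      have e2 : 2 + 2 * n = 2 * (n + 1) := by ring
      rw [e1] at h1
      rw [e2] at h2
      refine ⟨_, Submodule.add_mem _
        (Submodule.smul_mem _ (1 / (2 * n + 2) * (√Q.absDisc * (Q.absDisc : ℂ) ^ n)) h1)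
        (Submodule.smul_mem _ (-((2 * n + 1) / (2 * n + 2)) : ℂ) h2), fun z hz => ?_⟩
      have h3 := eval_pow_mul_sinh hQ n (hB z hz).1 (hB z hz).2
      have h4 : ((sinhInt (n + 1) (Q.angle z) : ℝ) : ℂ) =
          1 / (2 * n + 2) * ((Real.sinh (Q.angle z) ^ (2 * n + 1) *
            Real.cosh (Q.angle z) : ℝ) : ℂ) -
            (2 * n + 1) / (2 * n + 2) * (sinhInt n (Q.angle z) : ℂ) := by
        have h5 := congrArg ((↑) : ℝ → ℂ) (sinhInt_succ n (Q.angle z))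
        have h6 : (2 * (n : ℂ) + 2) ≠ 0 := by exact_mod_cast (2 * n + 1).succ_ne_zero
        push_cast at h5 ⊢
        field_simp
        linear_combination h5
      have h7 := hpe z hz
      simp only [term] at h7 ⊢
      rw [h4, termCoeff_succ]
      simp only [Pi.add_apply, Pi.smul_apply, Pi.mul_apply, Pi.pow_apply, smul_eq_mul]
      rw [mul_assoc (1 / (2 * (n : ℂ) + 2)), ← h3]
      linear_combination -((2 * n + 1) / (2 * n + 2)) * Q.eval z 1 * h7
  obtain ⟨p, hp, hpe⟩ := hdecomp n
  have hhol : DifferentiableOn ℂ (fun z => Q.eval z 1 ^ n * ℓ z) B :=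
    ((differentiable_eval Q).pow n).differentiableOn.mul hℓd
  rw [wz_iterate_of_antiPoly hBo hp (hhol.const_mul (termCoeff n)) hpe hz]
  have h8 : deriv^[2 * n + 1] (fun z => termCoeff n * (Q.eval z 1 ^ n * ℓ z)) z =
      termCoeff n * deriv^[2 * n + 1] (fun z => Q.eval z 1 ^ n * ℓ z) z := by
    rw [← iteratedDeriv_eq_iterate, ← iteratedDeriv_eq_iterate, iteratedDeriv_const_mul_field]
  rw [h8, iterate_deriv_eval_pow_mul Q hBo (fun z hz => (hB z hz).2) hℓ n hz]
  have hf : (n.factorial : ℂ) ≠ 0 := by exact_mod_cast n.factorial_ne_zero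
  rw [termCoeff, neg_pow (Q.absDisc : ℂ)]
  field_simp

end IntBQF

/-! ### Equivalence classes of forms -/

namespace IntBQF

variable {Q Q' : IntBQF}

theorem comp_mul (Q : IntBQF) (M N : SL(2, ℤ)) : Q.comp (M * N) = (Q.comp M).comp N := by
  ext <;> simp [comp, Matrix.mul_apply, Fin.sum_univ_two] <;> ring

theorem comp_one (Q : IntBQF) : Q.comp 1 = Q := by
  ext <;> simp [comp]

theorem det_eq_one (M : SL(2, ℤ)) : M 0 0 * M 1 1 - M 0 1 * M 1 0 = 1 := by
  rw [← Matrix.det_fin_two, M.det_coe]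

theorem absDisc_comp (Q : IntBQF) (M : SL(2, ℤ)) : (Q.comp M).absDisc = Q.absDisc := by
  have h : (Q.comp M).disc = Q.disc := by
    have h1 := det_eq_one M
    have h2 : (Q.comp M).disc = Q.disc * (M 0 0 * M 1 1 - M 0 1 * M 1 0) ^ 2 := by
      simp only [disc, comp]
      ring
    rw [h2, h1, one_pow, mul_one]
  rw [absDisc, absDisc, h]

theorem PosDef.comp (hQ : Q.PosDef) (M : SL(2, ℤ)) : (Q.comp M).PosDef := by
  intro x y hxy
  rw [eval_comp]
  apply hQ
  by_contra! h
  have h1 : ((M 0 0 : ℝ) * M 1 1 - M 0 1 * M 1 0) = 1 := by exact_mod_cast det_eq_one M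
  have h2 : x = 0 := by linear_combination (M 1 1 : ℝ) * h.1 - (M 0 1 : ℝ) * h.2 - x * h1
  have h3 : y = 0 := by linear_combination (M 0 0 : ℝ) * h.2 - (M 1 0 : ℝ) * h.1 - y * h1
  exact hxy.elim (· h2) (· h3)

theorem posDef_of_mem_cls (hQ : Q.PosDef) (h : Q' ∈ Q.cls) : Q'.PosDef := by
  obtain ⟨M, rfl⟩ := h
  exact hQ.comp M

theorem absDisc_of_mem_cls (h : Q' ∈ Q.cls) : Q'.absDisc = Q.absDisc := by
  obtain ⟨M, rfl⟩ := h
  exact absDisc_comp Q M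

theorem comp_mem_cls (h : Q' ∈ Q.cls) (M : SL(2, ℤ)) : Q'.comp M ∈ Q.cls := by
  obtain ⟨N, rfl⟩ := h
  exact ⟨N * M, (comp_mul Q N M).symm⟩

/-- The permutation `𝒬 ↦ 𝒬 ∘ M` of the class of `Q`. -/
def compEquiv (Q : IntBQF) (M : SL(2, ℤ)) : Q.cls ≃ Q.cls where
  toFun Q' := ⟨Q'.1.comp M, comp_mem_cls Q'.2 M⟩
  invFun Q' := ⟨Q'.1.comp M⁻¹, comp_mem_cls Q'.2 M⁻¹⟩
  left_inv Q' := by ext1; simp [← comp_mul, comp_one]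
  right_inv Q' := by ext1; simp [← comp_mul, comp_one]

theorem PosDef.one_le_a (hQ : Q.PosDef) : (1 : ℝ) ≤ Q.a := by
  have h := hQ.a_pos
  exact_mod_cast h

theorem PosDef.c_pos (hQ : Q.PosDef) : (0 : ℝ) < Q.c := by
  simpa [eval] using hQ 0 1 (Or.inr one_ne_zero)

/-! ### Convergence of the sum over a class -/

/-- The size `a + c` of a form, comparable to `Q_z` locally uniformly in `z`. -/
def size (Q : IntBQF) : ℝ := Q.a + Q.c

theorem PosDef.one_le_size (hQ : Q.PosDef) : 1 ≤ Q.size := by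
  have h1 := hQ.one_le_a
  have h2 := hQ.c_pos
  rw [size]
  linarith

theorem PosDef.size_pos (hQ : Q.PosDef) : 0 < Q.size := one_pos.trans_le hQ.one_le_size

/-- The least eigenvalue of a form is at least the determinant over the trace. -/
theorem le_size_mul_eval (Q : IntBQF) (x y : ℝ) :
    Q.absDisc / 4 * (x ^ 2 + y ^ 2) ≤ Q.size * Q.eval x y := by
  rw [absDisc_eq, size]
  simp only [eval]
  nlinarith [sq_nonneg (Q.a * x + Q.b / 2 * y), sq_nonneg (Q.b / 2 * x + Q.c * y)]

theorem im_sq_mul_size_le (hQ : Q.PosDef) (z : ℂ) :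
    z.im ^ 2 * Q.size ≤ Q.herm z * (z.re ^ 2 + z.im ^ 2 + 1) := by
  have h (x y : ℝ) : 0 ≤ Q.eval x y := by
    by_cases hxy : x ≠ 0 ∨ y ≠ 0
    · exact (hQ x y hxy).le
    · push Not at hxy
      simp [eval, hxy.1, hxy.2]
  -- the difference is `Q` applied to the square of a symmetric matrix, by Cayley-Hamilton
  have h1 := h (z.re ^ 2 + z.im ^ 2) z.re
  have h2 := h z.re 1
  rw [herm_eq, size]
  simp only [eval] at h1 h2
  linarith

theorem half_herm_le_norm_eval (hQ : Q.PosDef) (z : ℂ)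
    (h : 2 * Q.absDisc * z.im ^ 2 ≤ Q.herm z ^ 2) : Q.herm z / 2 ≤ ‖Q.eval z 1‖ := by
  have h1 := sq_norm_eval Q z
  have h2 := herm_pos hQ z
  refine le_of_sq_le_sq ?_ (norm_nonneg _)
  nlinarith

theorem summable_inv_one_add_sq : Summable fun m : ℤ => (1 + (m : ℝ) ^ 2)⁻¹ := by
  refine Summable.of_norm_bounded_eventually (Real.summable_one_div_int_pow.2 one_lt_two) ?_
  have h : ∀ᶠ m : ℤ in Filter.cofinite, m ≠ 0 :=
    (Set.finite_singleton 0).compl_mem_cofinite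
  filter_upwards [h] with m hm
  have hm' : (0 : ℝ) < (m : ℝ) ^ 2 := by positivity
  rw [Real.norm_of_nonneg (by positivity), one_div]
  exact inv_anti₀ hm' (by linarith)

/-- The sum over the class is dominated by a sum over first columns of matrices, which is of
Eisenstein type, times a sum over the translations fixing that column. -/
theorem summable_inv_size_pow (hQ : Q.PosDef) {k : ℕ} (hk : 2 ≤ k) :
    Summable fun Q' : Q.cls => (Q'.1.size ^ k)⁻¹ := by
  choose M hM using fun Q' : Q.cls => Q'.2
  set ψ : Q.cls → (Fin 2 → ℤ) × ℤ := fun Q' =>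
    (![M Q' 0 0, M Q' 1 0], Q'.1.b / (2 * Q'.1.a)) with hψ
  have hinj : Function.Injective ψ := by
    intro Q₁ Q₂ h
    simp only [hψ, Prod.mk.injEq] at h
    obtain ⟨h1, h2⟩ := h
    have h3 : M Q₁ 0 0 = M Q₂ 0 0 := by simpa using congrFun h1 0
    have h4 : M Q₁ 1 0 = M Q₂ 1 0 := by simpa using congrFun h1 1
    have d1 := det_eq_one (M Q₁)
    have d2 := det_eq_one (M Q₂)
    set m := M Q₁ 1 1 * M Q₂ 0 1 - M Q₁ 0 1 * M Q₂ 1 1 with hm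
    have e1 : M Q₂ 0 1 = M Q₁ 0 1 + m * M Q₂ 0 0 := by
      rw [hm, ← h3]
      rw [← h3, ← h4] at d2
      linear_combination M Q₁ 0 1 * d2 - M Q₂ 0 1 * d1
    have e2 : M Q₂ 1 1 = M Q₁ 1 1 + m * M Q₂ 1 0 := by
      rw [hm, ← h4]
      rw [← h3, ← h4] at d2
      linear_combination M Q₁ 1 1 * d2 - M Q₂ 1 1 * d1
    have a1 : Q₁.1.a = Q₂.1.a := by
      rw [hM Q₁, hM Q₂]
      simp only [comp, h3, h4]
    have b1 : Q₂.1.b = Q₁.1.b + 2 * Q₂.1.a * m := by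
      rw [hM Q₁, hM Q₂]
      simp only [comp, h3, h4, e1, e2]
      ring
    have hpos : (2 * Q₂.1.a) ≠ 0 := by
      have := (posDef_of_mem_cls hQ Q₂.2).a_pos
      have : 0 < Q₂.1.a := by exact_mod_cast this
      omega
    rw [b1, a1, Int.add_mul_ediv_left _ _ hpos] at h2
    have hm0 : m = 0 := by omega
    rw [hm0, zero_mul, add_zero] at e1 e2
    ext1
    rw [hM Q₁, hM Q₂]
    congr 1
    ext i j
    fin_cases i <;> fin_cases j <;> simp [h3, h4, e1, e2]
  have hD := hQ.absDisc_pos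
  have hsz := hQ.size_pos
  set c₀ : ℝ := Q.absDisc / (4 * Q.size) / 3 with hc₀
  have hc₀pos : 0 < c₀ := by positivity
  have hE : Summable fun x : Fin 2 → ℤ => ‖x‖ ^ (-(4 : ℝ)) :=
    EisensteinSeries.summable_one_div_norm_rpow (by norm_num)
  have hS := ((hE.mul_of_nonneg summable_inv_one_add_sq
    (fun x => Real.rpow_nonneg (norm_nonneg _) _)
    (fun m => by positivity)).mul_left (c₀ ^ 2)⁻¹).comp_injective hinj
  refine Summable.of_nonneg_of_le (fun Q' => ?_) (fun Q' => ?_) hS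
  · exact inv_nonneg.2 (pow_nonneg (posDef_of_mem_cls hQ Q'.2).size_pos.le _)
  have hQ' := posDef_of_mem_cls hQ Q'.2
  have hsize := hQ'.one_le_size
  have ha := hQ'.a_pos
  have hfst : ‖(ψ Q').1‖ ^ 2 ≤ (M Q' 0 0 : ℝ) ^ 2 + (M Q' 1 0 : ℝ) ^ 2 := by
    have h1 : ‖(ψ Q').1‖ ≤ √((M Q' 0 0 : ℝ) ^ 2 + (M Q' 1 0 : ℝ) ^ 2) := by
      refine (pi_norm_le_iff_of_nonneg (Real.sqrt_nonneg _)).2 fun i => ?_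
      fin_cases i
      · exact Real.abs_le_sqrt (by simp [hψ]; positivity)
      · exact Real.abs_le_sqrt (by simp [hψ]; positivity)
    calc _ ≤ √((M Q' 0 0 : ℝ) ^ 2 + (M Q' 1 0 : ℝ) ^ 2) ^ 2 := by gcongr
      _ = _ := Real.sq_sqrt (by positivity)
  have hx : 0 < ‖(ψ Q').1‖ := by
    refine norm_pos_iff.2 fun h0 => ?_
    have h1 : M Q' 0 0 = 0 := by simpa [hψ] using congrFun h0 0
    have h2 : M Q' 1 0 = 0 := by simpa [hψ] using congrFun h0 1
    have := det_eq_one (M Q')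
    simp [h1, h2] at this
  -- `a' = Q(α, γ)` for the first column `(α, γ)`
  have ha' : Q.absDisc / (4 * Q.size) * ‖(ψ Q').1‖ ^ 2 ≤ Q'.1.a := by
    have h1 := le_size_mul_eval Q (M Q' 0 0 : ℝ) (M Q' 1 0 : ℝ)
    have h2 : (Q'.1.a : ℝ) = Q.eval (M Q' 0 0 : ℝ) (M Q' 1 0 : ℝ) := by
      conv_lhs => rw [hM Q']
      simp only [comp, eval]
      push_cast
      ring
    rw [h2]
    calc _ ≤ Q.absDisc / (4 * Q.size) * ((M Q' 0 0 : ℝ) ^ 2 + (M Q' 1 0 : ℝ) ^ 2) := by gcongr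
      _ = Q.absDisc / 4 * ((M Q' 0 0 : ℝ) ^ 2 + (M Q' 1 0 : ℝ) ^ 2) / Q.size := by field_simp
      _ ≤ _ := by rw [div_le_iff₀ hsz]; linarith
  have hm : (Q'.1.a : ℝ) * (1 + ((ψ Q').2 : ℝ) ^ 2) / 3 ≤ Q'.1.size := by
    set m : ℤ := (ψ Q').2 with hmdef
    set r : ℤ := Q'.1.b % (2 * Q'.1.a) with hr
    have ha'' : 0 < Q'.1.a := by exact_mod_cast ha
    have h1 : Q'.1.b = 2 * Q'.1.a * m + r := (Int.mul_ediv_add_emod _ _).symm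
    have h2 : 0 ≤ r := Int.emod_nonneg _ (by omega)
    have h3 : r < 2 * Q'.1.a := Int.emod_lt_of_pos _ (by omega)
    have h1' : (Q'.1.b : ℝ) = 2 * Q'.1.a * m + r := by exact_mod_cast h1
    have h2' : (0 : ℝ) ≤ r := by exact_mod_cast h2
    have h3' : (r : ℝ) < 2 * Q'.1.a := by exact_mod_cast h3
    have h4 := hQ'.absDisc_pos
    rw [absDisc_eq] at h4
    have h5 : (2 * Q'.1.a * (m : ℝ)) ^ 2 ≤ 2 * (Q'.1.b : ℝ) ^ 2 + 2 * (r : ℝ) ^ 2 := by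
      rw [h1']
      nlinarith [sq_nonneg (2 * Q'.1.a * (m : ℝ) + 2 * r)]
    have h6 : (r : ℝ) ^ 2 ≤ 4 * (Q'.1.a : ℝ) ^ 2 := by nlinarith
    rw [div_le_iff₀ (by norm_num), size]
    have h7 : (Q'.1.a : ℝ) * (4 * (Q'.1.a * (1 + (m : ℝ) ^ 2))) ≤
        Q'.1.a * (4 * ((Q'.1.a + Q'.1.c) * 3)) := by nlinarith [sq_nonneg (Q'.1.b : ℝ)]
    linarith [le_of_mul_le_mul_left h7 ha]
  have hlow : c₀ * ‖(ψ Q').1‖ ^ 2 * (1 + ((ψ Q').2 : ℝ) ^ 2) ≤ Q'.1.size := by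
    refine le_trans ?_ hm
    have h1 : (0 : ℝ) ≤ (1 + ((ψ Q').2 : ℝ) ^ 2) / 3 := by positivity
    have := mul_le_mul_of_nonneg_right ha' h1
    calc _ = Q.absDisc / (4 * Q.size) * ‖(ψ Q').1‖ ^ 2 * ((1 + ((ψ Q').2 : ℝ) ^ 2) / 3) := by
          rw [hc₀]; ring
      _ ≤ _ := this
      _ = _ := by ring
  have hone : (1 : ℝ) ≤ 1 + ((ψ Q').2 : ℝ) ^ 2 := le_add_of_nonneg_right (sq_nonneg _)
  calc (Q'.1.size ^ k)⁻¹ ≤ (Q'.1.size ^ 2)⁻¹ :=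
        inv_anti₀ (by positivity) (pow_le_pow_right₀ hsize hk)
    _ ≤ ((c₀ * ‖(ψ Q').1‖ ^ 2 * (1 + ((ψ Q').2 : ℝ) ^ 2)) ^ 2)⁻¹ := by
        apply inv_anti₀ (by positivity)
        gcongr
    _ ≤ ((c₀ * ‖(ψ Q').1‖ ^ 2) ^ 2 * (1 + ((ψ Q').2 : ℝ) ^ 2))⁻¹ := by
        apply inv_anti₀ (by positivity)
        rw [mul_pow _ (1 + ((ψ Q').2 : ℝ) ^ 2)]
        gcongr
        exact le_self_pow₀ hone two_ne_zero
    _ = _ := by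
        simp only [Function.comp]
        rw [Real.rpow_neg (norm_nonneg _), show (4 : ℝ) = ((4 : ℕ) : ℝ) by norm_num,
          Real.rpow_natCast, mul_pow, mul_inv, mul_inv]
        ring

/-- Near any point `w` of the upper half-plane, the forms of the class not vanishing at `w` are
bounded below by constants whose inverse `k`-th powers are summable. -/
theorem exists_lower_bound (hQ : Q.PosDef) {k : ℕ} (hk : 2 ≤ k) {w : ℂ} (hw : 0 < w.im) :
    ∃ u : Q.cls → ℝ, (∀ Q', 0 < u Q') ∧ (Summable fun Q' => (u Q' ^ k)⁻¹) ∧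
      ∃ R > 0, ∀ z ∈ ball w R, 0 < z.im ∧
        ∀ Q' : Q.cls, Q'.1.eval w 1 ≠ 0 → u Q' ≤ ‖Q'.1.eval z 1‖ := by
  classical
  have hsum := summable_inv_size_pow hQ hk
  set y := w.im with hy
  set c : ℝ := (y / 2) ^ 2 / ((‖w‖ + y) ^ 2 + 1) with hc
  have hcpos : 0 < c := by positivity
  have hD := hQ.absDisc_pos
  set V : ℝ := √(2 * Q.absDisc) * (2 * y) / c with hV
  have hVpos : 0 < V := by positivity
  have hbig : ∀ᶠ Q' : Q.cls in Filter.cofinite, V ≤ Q'.1.size := by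
    have h1 := hsum.tendsto_cofinite_zero.eventually
      (gt_mem_nhds (show 0 < (V ^ k)⁻¹ by positivity))
    filter_upwards [h1] with Q' h
    have hpos := (posDef_of_mem_cls hQ Q'.2).size_pos
    by_contra! hlt
    exact absurd h (not_lt.2 (inv_anti₀ (by positivity) (pow_le_pow_left₀ hpos.le hlt.le k)))
  set S : Set Q.cls := {Q' | ¬ V ≤ Q'.1.size} with hS
  have hSfin : S.Finite := hbig
  refine ⟨fun Q' => if V ≤ Q'.1.size then c * Q'.1.size / 2 else
    if Q'.1.eval w 1 = 0 then 1 else ‖Q'.1.eval w 1‖ / 2, fun Q' => ?_, ?_, ?_⟩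
  · have hpos := (posDef_of_mem_cls hQ Q'.2).size_pos
    beta_reduce
    split_ifs with h1 h2
    · positivity
    · positivity
    · have := norm_pos_iff.2 h2
      positivity
  · refine (summable_congr_cofinite ?_).2 (hsum.mul_left ((c / 2) ^ k)⁻¹)
    filter_upwards [hbig] with Q' h
    rw [if_pos h, ← mul_inv, ← mul_pow]
    ring
  · have hnear : ∀ᶠ z in 𝓝 w, ∀ Q' ∈ S, Q'.1.eval w 1 ≠ 0 →
        ‖Q'.1.eval w 1‖ / 2 ≤ ‖Q'.1.eval z 1‖ := by
      rw [Filter.eventually_all_finite hSfin]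
      intro Q' _
      by_cases h0 : Q'.1.eval w 1 = 0
      · exact Filter.Eventually.of_forall fun z h => absurd h0 h
      · have hcont : Filter.Tendsto (fun z : ℂ => ‖Q'.1.eval z 1‖) (𝓝 w) (𝓝 ‖Q'.1.eval w 1‖) :=
          (differentiable_eval Q'.1).continuous.norm.continuousAt
        filter_upwards [hcont.eventually
          (lt_mem_nhds (half_lt_self (norm_pos_iff.2 h0)))] with z hz _ using hz.le
    obtain ⟨R, hR, hball⟩ := Metric.eventually_nhds_iff_ball.1 hnear
    refine ⟨min R (y / 2), by positivity, fun z hz => ?_⟩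
    have hzd : ‖z - w‖ < min R (y / 2) := by rw [← dist_eq_norm]; exact hz
    have him : |z.im - y| < y / 2 := by
      rw [hy, ← Complex.sub_im]
      exact (Complex.abs_im_le_norm _).trans_lt (hzd.trans_le (min_le_right _ _))
    rw [abs_lt] at him
    refine ⟨by linarith, fun Q' h0 => ?_⟩
    beta_reduce
    split_ifs with h1
    · have hQ' := posDef_of_mem_cls hQ Q'.2
      have hsz := hQ'.size_pos
      have hzn : ‖z‖ ≤ ‖w‖ + y := by
        have h2 := norm_add_le w (z - w)
        rw [add_sub_cancel] at h2
        have h3 := hzd.trans_le (min_le_right _ _)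
        linarith
      have h2 := im_sq_mul_size_le hQ' z
      have hzsq : z.re ^ 2 + z.im ^ 2 = ‖z‖ ^ 2 := by
        rw [Complex.sq_norm, Complex.normSq_apply]
        ring
      have h3 : c * Q'.1.size ≤ Q'.1.herm z := by
        have hh := herm_pos hQ' z
        rw [hc, div_mul_eq_mul_div, div_le_iff₀ (by positivity)]
        calc (y / 2) ^ 2 * Q'.1.size ≤ z.im ^ 2 * Q'.1.size := by gcongr; linarith
          _ ≤ Q'.1.herm z * (z.re ^ 2 + z.im ^ 2 + 1) := h2
          _ ≤ _ := by rw [hzsq]; gcongr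
      have h4 : √(2 * Q.absDisc) * (2 * y) ≤ c * Q'.1.size := by
        rw [hV, div_le_iff₀ hcpos] at h1
        linarith
      have h5 : 2 * Q'.1.absDisc * z.im ^ 2 ≤ Q'.1.herm z ^ 2 := by
        rw [absDisc_of_mem_cls Q'.2]
        calc 2 * Q.absDisc * z.im ^ 2 ≤ 2 * Q.absDisc * (2 * y) ^ 2 := by
              gcongr
              · linarith
              · linarith
          _ = (√(2 * Q.absDisc) * (2 * y)) ^ 2 := by
              rw [mul_pow (√(2 * Q.absDisc)), Real.sq_sqrt (by positivity)]
          _ ≤ _ := by gcongr; exact h4.trans h3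
      linarith [half_herm_le_norm_eval hQ' z h5]
    · exact hball z (ball_subset_ball (min_le_left _ _) hz) Q' h1 h0

/-- High up in a vertical strip, every form of the class is bounded below by its size. -/
theorem size_le_norm_eval (hQ : Q.PosDef) {z : ℂ} (hre : |z.re| ≤ 1) (him : 1 ≤ z.im)
    (hD : 2 * Q.absDisc ≤ z.im ^ 2) : Q.size / 6 ≤ ‖Q.eval z 1‖ := by
  have h1 := im_sq_mul_size_le hQ z
  have hh := herm_pos hQ z
  have hre2 : z.re ^ 2 ≤ 1 := by rw [← sq_abs]; exact pow_le_one₀ (abs_nonneg _) hre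
  have him2 : 1 ≤ z.im ^ 2 := one_le_pow₀ him
  have h2 : z.im ^ 2 * Q.size ≤ z.im ^ 2 * (3 * Q.herm z) := by nlinarith
  have h3 := le_of_mul_le_mul_left h2 (by linarith)
  have h4 : z.im ^ 2 ≤ Q.herm z := by
    have ha := hQ.one_le_a
    have hDp := hQ.absDisc_pos
    have h5 : 4 * Q.a * Q.herm z =
        (2 * Q.a * z.re + Q.b) ^ 2 + Q.absDisc + 4 * Q.a * (Q.a * z.im ^ 2) := by
      rw [herm_eq, absDisc_eq]
      ring
    have h6 : 4 * Q.a * (Q.a * z.im ^ 2) ≤ 4 * Q.a * Q.herm z := by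
      rw [h5]
      linarith [sq_nonneg (2 * Q.a * z.re + Q.b : ℝ)]
    have h7 := le_of_mul_le_mul_left h6 (by linarith)
    nlinarith
  have h5 : 2 * Q.absDisc * z.im ^ 2 ≤ Q.herm z ^ 2 := by nlinarith
  linarith [half_herm_le_norm_eval hQ z h5]

end IntBQF

/-! ### Operators on the upper half-plane and on the complex plane -/

theorem isOpen_im_pos : IsOpen {z : ℂ | 0 < z.im} :=
  isOpen_lt continuous_const Complex.continuous_im

theorem coe_ofComplex {z : ℂ} (hz : 0 < z.im) : (UpperHalfPlane.ofComplex z : ℂ) = z := by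
  rw [UpperHalfPlane.ofComplex_apply_of_im_pos hz]

theorem eventually_coe {w : ℍ} {P : ℂ → Prop} :
    (∀ᶠ z in 𝓝 (w : ℂ), P z) ↔ ∀ᶠ z : ℍ in 𝓝 w, P z := by
  rw [← UpperHalfPlane.isOpenEmbedding_coe.map_nhds_eq w, Filter.eventually_map]

theorem wz_const_mul (c : ℂ) (f : ℂ → ℂ) : wz (fun z => c * f z) = fun z => c * wz f z := by
  have h : fderiv ℝ (fun z => c * f z) = c • fderiv ℝ f := fderiv_const_smul_field (f := f) c
  ext z
  simp only [wz, h, Pi.smul_apply, smul_apply, smul_eq_mul]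
  ring

theorem wz_iterate_const_mul (c : ℂ) (m : ℕ) (f : ℂ → ℂ) :
    wz^[m] (fun z => c * f z) = fun z => c * wz^[m] f z := by
  induction m generalizing f with
  | zero => rfl
  | succ m ih => rw [Function.iterate_succ_apply, wz_const_mul, ih, Function.iterate_succ_apply]

theorem calD_iterate (m : ℕ) (F : ℍ → ℂ) (z : ℍ) :
    calD^[m] F z = (1 / (2 * (Real.pi : ℂ) * Complex.I)) ^ m *
      wz^[m] (F ∘ UpperHalfPlane.ofComplex) z := by
  induction m generalizing F with
  | zero => simp [UpperHalfPlane.ofComplex_apply]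
  | succ m ih =>
    have h : Set.EqOn (calD F ∘ UpperHalfPlane.ofComplex)
        (fun z => 1 / (2 * (Real.pi : ℂ) * Complex.I) * wz (F ∘ UpperHalfPlane.ofComplex) z)
        {z : ℂ | 0 < z.im} := by
      intro z hz
      simp only [Function.comp, calD, dz, dx, dy, wz, coe_ofComplex hz]
    rw [Function.iterate_succ_apply, ih, wz_iterate_congr isOpen_im_pos h m z.im_pos,
      wz_iterate_const_mul, Function.iterate_succ_apply, pow_succ]
    ring

/-- A real analytic function with `∂̄F = c yⁿ conj f`, `f` holomorphic, is annihilated by the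
Laplacian of weight `-n`. -/
theorem hypLaplacian_eq_zero {F : ℍ → ℂ} {n : ℕ} {c : ℂ} {f : ℂ → ℂ} {f' : ℂ} {z : ℍ}
    (ha : AnalyticAt ℝ (F ∘ UpperHalfPlane.ofComplex) (z : ℂ))
    (hbar : ∀ᶠ w in 𝓝 (z : ℂ),
      wzbar (F ∘ UpperHalfPlane.ofComplex) w = c * (w.im : ℂ) ^ n * conj (f w))
    (hf : HasDerivAt f f' z) : hypLaplacian (-n) F z = 0 := by
  set g : ℂ → ℂ := F ∘ UpperHalfPlane.ofComplex with hg
  set L := fderiv ℝ (fderiv ℝ g) z with hL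
  have hd : HasFDerivAt (fderiv ℝ g) L z := ha.fderiv.differentiableAt.hasFDerivAt
  have happ (v : ℂ) : HasFDerivAt (fun w => fderiv ℝ g w v) (L.flip v) z :=
    hd.clm_apply (hasFDerivAt_const v _) |>.congr_fderiv (by ext; simp)
  have hsymm : L 1 Complex.I = L Complex.I 1 :=
    (ha.contDiffAt (n := 2)).isSymmSndFDerivAt (by simp) 1 Complex.I
  have hupper : ∀ᶠ w in 𝓝 (z : ℂ), 0 < w.im := isOpen_im_pos.mem_nhds z.im_pos
  have hdx : dx F ∘ UpperHalfPlane.ofComplex =ᶠ[𝓝 (z : ℂ)] fun w => fderiv ℝ g w 1 := by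
    filter_upwards [hupper] with w hw
    simp [dx, coe_ofComplex hw, hg]
  have hdy : dy F ∘ UpperHalfPlane.ofComplex =ᶠ[𝓝 (z : ℂ)] fun w => fderiv ℝ g w Complex.I := by
    filter_upwards [hupper] with w hw
    simp [dy, coe_ofComplex hw, hg]
  have hxx : dx (dx F) z = L 1 1 := by
    rw [dx, hdx.fderiv_eq, (happ 1).fderiv]
    rfl
  have hyy : dy (dy F) z = L Complex.I Complex.I := by
    rw [dy, hdy.fderiv_eq, (happ Complex.I).fderiv]
    rfl
  have hfirst : dx F z + Complex.I * dy F z = 2 * (c * (z.im : ℂ) ^ n * conj (f z)) := by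
    have h := hbar.self_of_nhds
    simp only [wzbar] at h
    have h2 : dx F z + Complex.I * dy F z =
      fderiv ℝ g z 1 + Complex.I * fderiv ℝ g z Complex.I := rfl
    rw [h2, ← UpperHalfPlane.coe_im]
    linear_combination 2 * h
  -- `∂_x² + ∂_y² = 4 ∂∂̄`, and `∂̄F` is known explicitly
  have h1 : HasFDerivAt (wzbar g) ((2⁻¹ : ℂ) • (L.flip 1 + Complex.I • L.flip Complex.I)) z := by
    refine (((happ 1).add ((happ Complex.I).const_mul Complex.I)).const_mul (2⁻¹ : ℂ))
      |>.congr_of_eventuallyEq (Filter.Eventually.of_forall fun w => ?_)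
    simp only [wzbar, Pi.add_apply]
    ring
  have h2 : HasWirtinger (wzbar g) (c * (n * (z.im : ℂ) ^ (n - 1) * (1 / (2 * Complex.I))) *
      conj (f z)) _ z :=
    (((HasWirtinger.im.pow n).const_mul c).mul
      (HasWirtinger.of_hasDerivAt hf).conjugate).of_eq (by simp; ring) rfl
      |>.congr_of_eventuallyEq hbar
  have h3 := h2.wz_eq
  simp only [wz, h1.fderiv] at h3
  simp only [smul_apply, add_apply,
    ContinuousLinearMap.flip_apply, smul_eq_mul] at h3
  have h4 : L 1 1 + L Complex.I Complex.I =
      4 * (c * (n * (z.im : ℂ) ^ (n - 1) * (1 / (2 * Complex.I))) * conj (f z)) := by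
    rw [← h3, hsymm]
    linear_combination L Complex.I Complex.I * Complex.I_mul_I
  have hI : 1 / (2 * Complex.I) = -Complex.I / 2 := by
    field_simp
    simp
  rw [hypLaplacian, hxx, hyy, hfirst, h4, hI]
  rcases n with _ | n
  · simp
  · rw [Nat.add_sub_cancel]
    push_cast
    ring

/-! ### Transformation under the modular group -/

namespace IntBQF

variable {Q Q' Q'' : IntBQF}

theorem eval_comp_coe (Q : IntBQF) (M : SL(2, ℤ)) (z : ℍ) :
    (Q.comp M).eval (z : ℂ) 1 =
      UpperHalfPlane.denom M z ^ 2 * Q.eval ((M • z : ℍ) : ℂ) 1 := by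
  have h0 : UpperHalfPlane.denom M z ≠ 0 := UpperHalfPlane.denom_ne_zero _ z
  rw [ModularGroup.denom_apply] at h0 ⊢
  rw [eval_comp, UpperHalfPlane.coe_specialLinearGroup_apply]
  simp only [algebraMap_int_eq, eq_intCast, Complex.ofReal_intCast, eval, mul_one]
  generalize (M 1 0 : ℂ) * z + M 1 1 = δ at h0 ⊢
  field_simp

theorem atPoint_eq (Q : IntBQF) (z : ℍ) : Q.atPoint z = (z.im)⁻¹ * Q.herm z := rfl

theorem atPoint_pos (hQ : Q.PosDef) (z : ℍ) : 0 < Q.atPoint z :=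
  mul_pos (inv_pos.2 z.im_pos) (herm_pos hQ z)

theorem atPoint_sq (Q : IntBQF) (z : ℍ) :
    Q.atPoint z ^ 2 = Q.absDisc + (‖Q.eval (z : ℂ) 1‖ / z.im) ^ 2 := by
  have hy := z.im_ne_zero
  rw [atPoint_eq, div_pow, sq_norm_eval, UpperHalfPlane.coe_im]
  field_simp
  ring

theorem atPoint_comp (hQ : Q.PosDef) (M : SL(2, ℤ)) (z : ℍ) :
    (Q.comp M).atPoint z = Q.atPoint (M • z) := by
  refine (pow_left_inj₀ (atPoint_pos (hQ.comp M) z).le (atPoint_pos hQ _).le two_ne_zero).1 ?_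
  rw [atPoint_sq, atPoint_sq, absDisc_comp, eval_comp_coe, ModularGroup.im_smul_eq_div_normSq,
    Complex.normSq_eq_norm_sq, norm_mul, norm_pow]
  congr 2
  have h0 : ‖UpperHalfPlane.denom M z‖ ≠ 0 :=
    norm_ne_zero_iff.2 (UpperHalfPlane.denom_ne_zero _ z)
  have hy := z.im_ne_zero
  field_simp

theorem GTerm_comp (k : ℕ) (hQ : Q.PosDef) (M : SL(2, ℤ)) (z : ℍ) :
    GTerm k (Q.comp M) z = UpperHalfPlane.denom M z ^ (2 * (k - 1)) * GTerm k Q (M • z) := by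
  simp only [GTerm, atPoint_comp hQ, absDisc_comp, eval_comp_coe, mul_pow, ← pow_mul]
  ring

theorem GQ_slash (k : ℕ) (hk : 2 ≤ k) (hQ : Q.PosDef) (M : SL(2, ℤ)) :
    (GQ k Q) ∣[(2 - 2 * (k : ℤ))] M = GQ k Q := by
  ext z
  rw [ModularForm.SL_slash_apply, GQ, GQ, ← (compEquiv Q M).tsum_eq fun Q' => GTerm k Q' z]
  have h : ∀ Q' : Q.cls, GTerm k ((compEquiv Q M) Q') z =
      UpperHalfPlane.denom M z ^ (2 * (k - 1)) * GTerm k Q' (M • z) :=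
    fun Q' => GTerm_comp k (posDef_of_mem_cls hQ Q'.2) M z
  simp only [h, tsum_mul_left]
  have h2 : -(2 - 2 * (k : ℤ)) = ((2 * (k - 1) : ℕ) : ℤ) := by omega
  rw [h2, zpow_natCast]
  ring

/-! ### Zeros of the forms of a class -/

theorem eval_sub_eval (Q : IntBQF) (z w : ℂ) :
    Q.eval z 1 - Q.eval w 1 = (z - w) * (Q.a * (z + w) + Q.b) := by
  rw [eval_one, eval_one]
  ring

theorem im_le_norm_divided_difference (hQ : Q.PosDef) {z w : ℂ} (hz : 0 < z.im) (hw : 0 < w.im) :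
    w.im ≤ ‖(Q.a : ℂ) * (z + w) + Q.b‖ := by
  refine le_trans ?_ ((le_abs_self _).trans (Complex.abs_im_le_norm _))
  have h : ((Q.a : ℂ) * (z + w) + Q.b).im = Q.a * (z.im + w.im) := by simp
  rw [h]
  nlinarith [hQ.one_le_a]

theorem im_mul_norm_sub_le (hQ : Q.PosDef) {z w : ℂ} (hz : 0 < z.im) (hw : 0 < w.im)
    (h : Q.eval w 1 = 0) : w.im * ‖z - w‖ ≤ ‖Q.eval z 1‖ := by
  have h1 := eval_sub_eval Q z w
  rw [h, sub_zero] at h1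
  rw [h1, norm_mul, mul_comm]
  exact mul_le_mul_of_nonneg_left (im_le_norm_divided_difference hQ hz hw) (norm_nonneg _)

theorem root_unique (hQ : Q.PosDef) {z w : ℂ} (hz : 0 < z.im) (hw : 0 < w.im)
    (h1 : Q.eval z 1 = 0) (h2 : Q.eval w 1 = 0) : z = w := by
  have h := im_mul_norm_sub_le hQ hz hw h2
  rw [h1, norm_zero] at h
  have h3 : ‖z - w‖ ≤ 0 := by
    by_contra! h4
    linarith [mul_pos hw h4]
  exact sub_eq_zero.1 (norm_le_zero_iff.1 h3)

/-- A positive-definite form is determined by its discriminant and its root. -/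
theorem eq_of_common_root (hQ' : Q' ∈ Q.cls) (hQ'' : Q'' ∈ Q.cls) (hQ : Q.PosDef) {z : ℂ}
    (hz : 0 < z.im) (h1 : Q'.eval z 1 = 0) (h2 : Q''.eval z 1 = 0) : Q' = Q'' := by
  have key : ∀ P ∈ Q.cls, P.eval z 1 = 0 → (P.b : ℝ) = -2 * P.a * z.re ∧
      (P.c : ℝ) = P.a * (z.re ^ 2 + z.im ^ 2) ∧ (2 * P.a * z.im) ^ 2 = Q.absDisc := by
    intro P hP h
    rw [eval_one] at h
    have hre := congrArg Complex.re h
    have him := congrArg Complex.im h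
    simp [pow_two] at hre him
    have hb : (P.b : ℝ) = -2 * P.a * z.re :=
      mul_right_cancel₀ hz.ne' (by linear_combination him)
    have hc : (P.c : ℝ) = P.a * (z.re ^ 2 + z.im ^ 2) := by
      rw [hb] at hre
      linear_combination hre
    refine ⟨hb, hc, ?_⟩
    rw [← absDisc_of_mem_cls hP, absDisc_eq, hb, hc]
    ring
  obtain ⟨b1, c1, d1⟩ := key Q' hQ' h1
  obtain ⟨b2, c2, d2⟩ := key Q'' hQ'' h2
  have p1 := (posDef_of_mem_cls hQ hQ').a_pos
  have p2 := (posDef_of_mem_cls hQ hQ'').a_pos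
  have h3 := (pow_left_inj₀ (by positivity) (by positivity) two_ne_zero).1 (d1.trans d2.symm)
  have ha : (Q'.a : ℝ) = Q''.a := mul_left_cancel₀ two_ne_zero (mul_right_cancel₀ hz.ne' h3)
  rw [← ha] at b2 c2
  ext
  · exact_mod_cast ha
  · exact_mod_cast b1.trans b2.symm
  · exact_mod_cast c1.trans c2.symm

theorem mem_orbit_tau_iff (hQ : Q.PosDef) (z : ℍ) :
    z ∈ MulAction.orbit SL(2, ℤ) (Q.tau hQ) ↔ ∃ Q' ∈ Q.cls, Q'.eval (z : ℂ) 1 = 0 := by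
  constructor
  · rintro ⟨M, rfl⟩
    refine ⟨Q.comp M⁻¹, ⟨M⁻¹, rfl⟩, ?_⟩
    rw [eval_comp_coe]
    simp [eval_tau]
  · rintro ⟨_, ⟨M, rfl⟩, h⟩
    rw [eval_comp_coe] at h
    have h0 : UpperHalfPlane.denom M z ^ 2 ≠ 0 := pow_ne_zero 2 (UpperHalfPlane.denom_ne_zero _ z)
    have h1 := (mul_eq_zero.1 h).resolve_left h0
    have h2 := root_unique hQ (M • z).im_pos (Q.tau hQ).im_pos h1 (eval_tau Q hQ)
    refine ⟨M⁻¹, ?_⟩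
    have h3 : M • z = Q.tau hQ := UpperHalfPlane.ext h2
    simp [← h3]

end IntBQF

/-! ### The series away from and near the orbit -/

namespace IntBQF

variable {Q : IntBQF} {k n : ℕ}

theorem GTerm_eq_term (n : ℕ) (Q : IntBQF) (z : ℍ) : GTerm (n + 1) Q z = term n Q z := by
  have hy := z.im_ne_zero
  have h : √Q.absDisc / Q.atPoint z = √Q.absDisc * (z : ℂ).im / Q.herm z := by
    rw [atPoint_eq, UpperHalfPlane.coe_im]
    field_simp
  have h2 : 2 * (n + 1) - 2 = 2 * n := by omega
  rw [GTerm, term, sinhInt, angle, h, h2, Nat.add_sub_cancel]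

theorem fTerm_eq (k : ℕ) (Q : IntBQF) (z : ℍ) : fTerm k Q z = (Q.eval (z : ℂ) 1 ^ k)⁻¹ := by
  rw [fTerm, zpow_neg, zpow_natCast]

/-- The unnormalized series defining `𝒢_Q`, as a function on `ℂ`. -/
def termSum (n : ℕ) (Q : IntBQF) (z : ℂ) : ℂ := ∑' Q' : Q.cls, term n Q' z

/-- The unnormalized series defining `f_Q`, as a function on `ℂ`. -/
def invSum (k : ℕ) (Q : IntBQF) (z : ℂ) : ℂ := ∑' Q' : Q.cls, (Q'.1.eval z 1 ^ k)⁻¹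

/-- The normalizing factor of `𝒢_Q`. -/
def normFactor (n : ℕ) (Q : IntBQF) : ℝ := Q.absDisc ^ ((1 - ((n + 1 : ℕ) : ℝ)) / 2)

theorem normFactor_pos (n : ℕ) (hQ : Q.PosDef) : 0 < normFactor n Q :=
  Real.rpow_pos_of_pos hQ.absDisc_pos _

theorem GQ_eq (n : ℕ) (Q : IntBQF) (z : ℍ) :
    GQ (n + 1) Q z = normFactor n Q * termSum n Q z := by
  simp only [GQ, GTerm_eq_term, termSum, normFactor]

theorem GQ_comp_ofComplex (n : ℕ) (Q : IntBQF) :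
    Set.EqOn (GQ (n + 1) Q ∘ UpperHalfPlane.ofComplex)
      (fun z => normFactor n Q * termSum n Q z) {z : ℂ | 0 < z.im} := by
  intro z hz
  rw [Function.comp_apply, GQ_eq, coe_ofComplex hz]

/-- The normalizing factors of `f_Q` and `𝒢_Q` differ by `D^{n + 1/2}`. -/
theorem normFactor_mul (n : ℕ) (hQ : Q.PosDef) :
    normFactor n Q * (√Q.absDisc * Q.absDisc ^ n) = Q.absDisc ^ (((n + 1 : ℕ) : ℝ) / 2) := by
  have hD := hQ.absDisc_pos
  rw [normFactor, Real.sqrt_eq_rpow, ← Real.rpow_natCast, ← Real.rpow_add hD, ← Real.rpow_add hD]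
  congr 1
  push_cast
  ring

theorem fQ_eq (n : ℕ) (hQ : Q.PosDef) (z : ℍ) :
    fQ (n + 1) Q z = normFactor n Q * (√Q.absDisc * (Q.absDisc : ℂ) ^ n) * invSum (n + 1) Q z := by
  simp only [fQ, fTerm_eq, invSum]
  rw [← normFactor_mul n hQ]
  push_cast
  ring

/-- Bounds for all summands not singular at `w`, in a disc around `w`. -/
theorem exists_bounds (hQ : Q.PosDef) (hn : 1 ≤ n) {w : ℂ} (hw : 0 < w.im) :
    ∃ u : Q.cls → ℝ, Summable u ∧ ∃ R > 0, ∀ z ∈ ball w R, 0 < z.im ∧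
      ∀ Q' : Q.cls, Q'.1.eval w 1 ≠ 0 → Q'.1.eval z 1 ≠ 0 ∧
        ‖(Q'.1.eval z 1 ^ (n + 1))⁻¹‖ ≤ u Q' ∧ ‖term n Q'.1 z‖ ≤ u Q' := by
  obtain ⟨v, hv, hsum, R, hR, h⟩ := exists_lower_bound hQ (k := n + 1) (by omega) hw
  set C : ℝ := (√Q.absDisc * (w.im + R)) ^ (2 * n + 1) with hC
  have hC0 : 0 ≤ C := by positivity
  refine ⟨fun Q' => (1 + C) * (v Q' ^ (n + 1))⁻¹, hsum.mul_left _, R, hR, fun z hz => ?_⟩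
  obtain ⟨hz0, hz1⟩ := h z hz
  refine ⟨hz0, fun Q' hQ'w => ?_⟩
  have h1 := hz1 Q' hQ'w
  have hvpos := hv Q'
  have hq : Q'.1.eval z 1 ≠ 0 := norm_pos_iff.1 (hvpos.trans_le h1)
  have him : z.im ≤ w.im + R := by
    have h2 : |z.im - w.im| ≤ ‖z - w‖ := by
      rw [← Complex.sub_im]
      exact Complex.abs_im_le_norm _
    have h3 : ‖z - w‖ < R := by rw [← dist_eq_norm]; exact hz
    linarith [le_abs_self (z.im - w.im)]
  have h4 : (‖Q'.1.eval z 1‖ ^ (n + 1))⁻¹ ≤ (v Q' ^ (n + 1))⁻¹ :=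
    inv_anti₀ (by positivity) (by gcongr)
  have h5 : 0 ≤ (v Q' ^ (n + 1))⁻¹ := by positivity
  refine ⟨hq, ?_, ?_⟩
  · rw [norm_inv, norm_pow]
    nlinarith
  · refine (norm_term_le n (posDef_of_mem_cls hQ Q'.2) hz0 hq).trans ?_
    rw [absDisc_of_mem_cls Q'.2]
    calc _ ≤ C * (v Q' ^ (n + 1))⁻¹ := by
          rw [hC]
          gcongr
      _ ≤ _ := by nlinarith

/-- Near a point where no form of the class vanishes, the series for `𝒢_Q` converges absolutely to
a real analytic function which may be differentiated termwise. -/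
theorem termSum_properties (hQ : Q.PosDef) (hn : 1 ≤ n) {w : ℂ} (hw : 0 < w.im)
    (hne : ∀ Q' ∈ Q.cls, Q'.eval w 1 ≠ 0) :
    (Summable fun Q' : Q.cls => ‖(Q'.1.eval w 1 ^ (n + 1))⁻¹‖) ∧
    (Summable fun Q' : Q.cls => ‖term n Q'.1 w‖) ∧
    AnalyticAt ℝ (termSum n Q) w ∧
    (∀ᶠ z in 𝓝 w, wzbar (termSum n Q) z = Complex.I * √Q.absDisc / 2 * (Q.absDisc : ℂ) ^ n *
      (z.im : ℂ) ^ (2 * n) * conj (invSum (n + 1) Q z)) ∧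
    DifferentiableAt ℂ (invSum (n + 1) Q) w ∧
    wz^[2 * n + 1] (termSum n Q) w = -Complex.I * √Q.absDisc / 2 * (-Q.absDisc : ℂ) ^ n *
      (2 * n).factorial / 4 ^ n * invSum (n + 1) Q w := by
  obtain ⟨u, hu, R, hR, h⟩ := exists_bounds hQ hn hw
  have hwB : w ∈ ball w R := mem_ball_self hR
  have him : ∀ z ∈ ball w R, 0 < z.im := fun z hz => (h z hz).1
  have hq : ∀ Q' : Q.cls, ∀ z ∈ ball w R, Q'.1.eval z 1 ≠ 0 := fun Q' z hz =>
    ((h z hz).2 Q' (hne Q' Q'.2)).1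
  have hfu : ∀ Q' : Q.cls, ∀ z ∈ ball w R, ‖(Q'.1.eval z 1 ^ (n + 1))⁻¹‖ ≤ u Q' :=
    fun Q' z hz => ((h z hz).2 Q' (hne Q' Q'.2)).2.1
  have hgu : ∀ Q' : Q.cls, ∀ z ∈ ball w R, ‖term n Q'.1 z‖ ≤ u Q' :=
    fun Q' z hz => ((h z hz).2 Q' (hne Q' Q'.2)).2.2
  have hf : ∀ Q' : Q.cls, DifferentiableOn ℂ (fun z : ℂ => (Q'.1.eval z 1 ^ (n + 1))⁻¹)
      (ball w R) := fun Q' =>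
    ((differentiable_eval Q'.1).pow (n + 1)).differentiableOn.inv
      fun z hz => pow_ne_zero _ (hq Q' z hz)
  have hg : ∀ Q' : Q.cls, ∀ z, ∃ A, z ∈ ball w R → HasWirtinger (term n Q'.1) A
      (Complex.I * √Q.absDisc / 2 * (Q.absDisc : ℂ) ^ n * (z.im : ℂ) ^ (2 * n) *
        conj ((Q'.1.eval z 1 ^ (n + 1))⁻¹)) z := by
    intro Q' z
    by_cases hz : z ∈ ball w R
    · obtain ⟨A, hA⟩ := hasWirtinger_term n (posDef_of_mem_cls hQ Q'.2) (him z hz) (hq Q' z hz)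
      rw [absDisc_of_mem_cls Q'.2] at hA
      exact ⟨A, fun _ => hA⟩
    · exact ⟨0, fun h => absurd h hz⟩
  choose A hA using hg
  obtain ⟨h1, h2, h3⟩ := tsum_of_wzbar_eq hu hf hA hfu hgu
  refine ⟨Summable.of_nonneg_of_le (fun _ => norm_nonneg _) (fun Q' => hfu Q' w hwB) hu,
    Summable.of_nonneg_of_le (fun _ => norm_nonneg _) (fun Q' => hgu Q' w hwB) hu,
    h1 w hwB, ?_, ?_, ?_⟩
  · filter_upwards [isOpen_ball.mem_nhds hwB] with z hz
    obtain ⟨A', hA'⟩ := h2 z hz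
    exact hA'.wzbar_eq
  · exact (Complex.differentiableOn_tsum_of_summable_norm hu hf isOpen_ball
      hfu).differentiableAt (isOpen_ball.mem_nhds hwB)
  · refine (h3 w hwB).tsum_eq.symm.trans ?_
    rw [invSum, ← tsum_mul_left]
    refine tsum_congr fun Q' => ?_
    have h4 := wz_iterate_term (posDef_of_mem_cls hQ Q'.2) n
      (fun z hz => ⟨him z hz, hq Q' z hz⟩) hwB
    rw [absDisc_of_mem_cls Q'.2] at h4
    exact h4

/-- Near a zero `w` of the form `Q₀`, the series for `𝒢_Q` is the summand of `Q₀` up to a bounded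
function. -/
theorem exists_norm_termSum_sub_le (hQ : Q.PosDef) (hn : 1 ≤ n) {w : ℂ} (hw : 0 < w.im)
    {Q₀ : IntBQF} (h₀ : Q₀ ∈ Q.cls) (hzero : Q₀.eval w 1 = 0) :
    ∃ C, ∀ᶠ z in 𝓝 w, ‖termSum n Q z - term n Q₀ z‖ ≤ C := by
  classical
  obtain ⟨u, hu, R, hR, h⟩ := exists_bounds hQ hn hw
  have hne : ∀ Q' : Q.cls, Q' ≠ ⟨Q₀, h₀⟩ → Q'.1.eval w 1 ≠ 0 := fun Q' hne h1 =>
    hne (Subtype.ext (eq_of_common_root Q'.2 h₀ hQ hw h1 hzero))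
  refine ⟨∑' Q', |u Q'|, ?_⟩
  filter_upwards [ball_mem_nhds w hR] with z hz
  have hbd : ∀ Q' : Q.cls, ‖if Q' = ⟨Q₀, h₀⟩ then 0 else term n Q'.1 z‖ ≤ |u Q'| := by
    intro Q'
    split_ifs with h1
    · simp
    · exact ((h z hz).2 Q' (hne Q' h1)).2.2.trans (le_abs_self _)
  have hs1 : Summable fun Q' : Q.cls => if Q' = ⟨Q₀, h₀⟩ then 0 else term n Q'.1 z :=
    Summable.of_norm_bounded hu.abs hbd
  have hs2 : Summable fun Q' : Q.cls => term n Q'.1 z := by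
    refine (summable_congr_cofinite ?_).1 hs1
    filter_upwards [(Set.finite_singleton (⟨Q₀, h₀⟩ : Q.cls)).compl_mem_cofinite] with Q' h1
    exact if_neg h1
  rw [termSum, hs2.tsum_eq_add_tsum_ite ⟨Q₀, h₀⟩, add_sub_cancel_left]
  exact tsum_of_norm_bounded hu.abs.hasSum hbd

theorem term_eq_zero (hn : 1 ≤ n) {Q₀ : IntBQF} {z : ℂ} (h : Q₀.eval z 1 = 0) :
    term n Q₀ z = 0 := by
  rw [term, h, zero_pow (by omega), zero_mul]

theorem not_boundedNear (hQ : Q.PosDef) (hn : 1 ≤ n) {w : ℍ} {Q₀ : IntBQF} (h₀ : Q₀ ∈ Q.cls)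
    (hzero : Q₀.eval (w : ℂ) 1 = 0) : ¬ BoundedNear (GQ (n + 1) Q) w := by
  rintro ⟨C, hC⟩
  have hpos := normFactor_pos n hQ
  have hQ₀ := posDef_of_mem_cls hQ h₀
  simp only [GQ_eq, norm_mul, Complex.norm_real, Real.norm_of_nonneg hpos.le] at hC
  rw [← eventually_coe (P := fun z => normFactor n Q * ‖termSum n Q z‖ ≤ C)] at hC
  obtain ⟨C', hC'⟩ := exists_norm_termSum_sub_le hQ hn w.im_pos h₀ hzero
  have hterm : ∀ᶠ z in 𝓝 (w : ℂ), ‖term n Q₀ z‖ ≤ C / normFactor n Q + C' := by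
    filter_upwards [hC, hC'] with z h1 h2
    have h3 : ‖termSum n Q z‖ ≤ C / normFactor n Q := by
      rw [le_div_iff₀ hpos]
      linarith
    have h4 := norm_sub_le (termSum n Q z) (termSum n Q z - term n Q₀ z)
    rw [sub_sub_cancel] at h4
    linarith
  set K := C / normFactor n Q + C' with hK
  -- pass to the limit in the lower bound for the singular summand
  have hev : ∀ᶠ z in 𝓝[≠] (w : ℂ), (√Q₀.absDisc * z.im) ^ (2 * n) ≤
      4 * n * K * ‖Q₀.eval z 1‖ ^ n +
        2 * n * (√Q₀.absDisc * z.im) * ‖Q₀.eval z 1‖ ^ (2 * n - 1) := by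
    filter_upwards [nhdsWithin_le_nhds hterm,
      nhdsWithin_le_nhds (isOpen_im_pos.mem_nhds w.im_pos), self_mem_nhdsWithin] with z h1 h2 h3
    have hq : Q₀.eval z 1 ≠ 0 := fun h => h3 (root_unique hQ₀ h2 w.im_pos h hzero)
    refine (le_norm_term hn hQ₀ h2 hq).trans ?_
    gcongr
  have hqc : Continuous fun z : ℂ => ‖Q₀.eval z 1‖ := (differentiable_eval Q₀).continuous.norm
  have hl : Filter.Tendsto (fun z : ℂ => (√Q₀.absDisc * z.im) ^ (2 * n)) (𝓝[≠] (w : ℂ))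
      (𝓝 ((√Q₀.absDisc * (w : ℂ).im) ^ (2 * n))) :=
    (Continuous.tendsto (by fun_prop) _).mono_left nhdsWithin_le_nhds
  have hr : Filter.Tendsto (fun z : ℂ => 4 * n * K * ‖Q₀.eval z 1‖ ^ n +
      2 * n * (√Q₀.absDisc * z.im) * ‖Q₀.eval z 1‖ ^ (2 * n - 1)) (𝓝[≠] (w : ℂ))
      (𝓝 (4 * n * K * ‖Q₀.eval (w : ℂ) 1‖ ^ n +
        2 * n * (√Q₀.absDisc * (w : ℂ).im) * ‖Q₀.eval (w : ℂ) 1‖ ^ (2 * n - 1))) :=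
    (Continuous.tendsto (f := fun z : ℂ => 4 * n * K * ‖Q₀.eval z 1‖ ^ n +
      2 * n * (√Q₀.absDisc * z.im) * ‖Q₀.eval z 1‖ ^ (2 * n - 1)) (by fun_prop) _).mono_left
      nhdsWithin_le_nhds
  have hle := le_of_tendsto_of_tendsto hl hr hev
  rw [hzero, norm_zero, zero_pow (by omega), zero_pow (by omega), mul_zero, mul_zero,
    add_zero] at hle
  have h5 := Real.sqrt_pos.2 hQ₀.absDisc_pos
  have h6 := w.im_pos
  rw [← UpperHalfPlane.coe_im] at h6
  exact absurd hle (not_le.2 (by positivity))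

/-- At a zero of a form of the class, `𝒢_Q` has a singularity of finite order. -/
theorem boundedNear_pow_mul (hQ : Q.PosDef) (hn : 1 ≤ n) {w : ℍ} {Q₀ : IntBQF} (h₀ : Q₀ ∈ Q.cls)
    (hzero : Q₀.eval (w : ℂ) 1 = 0) :
    BoundedNear (fun z => ((z : ℂ) - w) ^ (n + 1) * GQ (n + 1) Q z) w := by
  have hpos := normFactor_pos n hQ
  have hQ₀ := posDef_of_mem_cls hQ h₀
  obtain ⟨C', hC'⟩ := exists_norm_termSum_sub_le hQ hn w.im_pos h₀ hzero
  have hw : 0 < (w : ℂ).im := w.im_pos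
  set K : ℝ := (√Q₀.absDisc * ((w : ℂ).im + 1)) ^ (2 * n + 1) * ((w : ℂ).im ^ (n + 1))⁻¹ with hK
  refine ⟨normFactor n Q * (K + C'), ?_⟩
  simp only [GQ_eq]
  rw [← eventually_coe (P := fun z => ‖(z - w) ^ (n + 1) * (normFactor n Q * termSum n Q z)‖ ≤
    normFactor n Q * (K + C'))]
  filter_upwards [hC', isOpen_im_pos.mem_nhds w.im_pos, ball_mem_nhds (w : ℂ) one_pos]
    with z h1 h2 h3
  have h2' : 0 < z.im := h2
  have hzw : ‖z - w‖ < 1 := by rw [← dist_eq_norm]; exact h3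
  have him : z.im ≤ (w : ℂ).im + 1 := by
    have h4 := (Complex.abs_im_le_norm (z - w)).trans hzw.le
    rw [Complex.sub_im] at h4
    linarith [le_abs_self (z.im - (w : ℂ).im)]
  have hsing : ‖z - w‖ ^ (n + 1) * ‖term n Q₀ z‖ ≤ K := by
    by_cases hq : Q₀.eval z 1 = 0
    · rw [term_eq_zero hn hq, norm_zero, mul_zero]
      positivity
    · have h4 := im_mul_norm_sub_le hQ₀ h2 w.im_pos hzero
      have h5 := norm_term_le n hQ₀ h2 hq
      have hqp : 0 < ‖Q₀.eval z 1‖ := norm_pos_iff.2 hq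
      have h6 : ‖z - w‖ ^ (n + 1) * (‖Q₀.eval z 1‖ ^ (n + 1))⁻¹ ≤ ((w : ℂ).im ^ (n + 1))⁻¹ := by
        rw [← div_eq_mul_inv, div_le_iff₀ (by positivity), inv_mul_eq_div,
          le_div_iff₀ (by positivity), ← mul_pow]
        gcongr
        linarith
      calc _ ≤ ‖z - w‖ ^ (n + 1) *
            ((√Q₀.absDisc * z.im) ^ (2 * n + 1) * (‖Q₀.eval z 1‖ ^ (n + 1))⁻¹) := by gcongr
        _ = (√Q₀.absDisc * z.im) ^ (2 * n + 1) *
            (‖z - w‖ ^ (n + 1) * (‖Q₀.eval z 1‖ ^ (n + 1))⁻¹) := by ring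
        _ ≤ _ := by
          rw [hK]
          gcongr
  have hrest : ‖z - w‖ ^ (n + 1) * ‖termSum n Q z - term n Q₀ z‖ ≤ C' :=
    (mul_le_of_le_one_left (norm_nonneg _) (pow_le_one₀ (norm_nonneg _) hzw.le)).trans h1
  have htri : ‖termSum n Q z‖ ≤ ‖term n Q₀ z‖ + ‖termSum n Q z - term n Q₀ z‖ := by
    have h4 := norm_add_le (term n Q₀ z) (termSum n Q z - term n Q₀ z)
    rwa [add_sub_cancel] at h4
  rw [norm_mul, norm_mul, norm_pow, Complex.norm_real, Real.norm_of_nonneg hpos.le]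
  calc _ = normFactor n Q * (‖z - w‖ ^ (n + 1) * ‖termSum n Q z‖) := by ring
    _ ≤ normFactor n Q * (‖z - w‖ ^ (n + 1) *
        (‖term n Q₀ z‖ + ‖termSum n Q z - term n Q₀ z‖)) := by gcongr
    _ ≤ _ := by
      rw [mul_add]
      gcongr

/-- The orbit of `τ_Q` has no accumulation point. -/
theorem eventually_ne_zero (hQ : Q.PosDef) (w : ℍ) :
    ∀ᶠ z : ℍ in 𝓝[≠] w, ∀ Q' ∈ Q.cls, Q'.eval (z : ℂ) 1 ≠ 0 := by
  obtain ⟨u, hu, R, hR, h⟩ := exists_bounds hQ le_rfl w.im_pos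
  have h1 : ∀ᶠ z : ℍ in 𝓝 w, (z : ℂ) ∈ ball (w : ℂ) R :=
    (eventually_coe (P := fun z => z ∈ ball (w : ℂ) R)).1 (ball_mem_nhds _ hR)
  filter_upwards [nhdsWithin_le_nhds h1, self_mem_nhdsWithin] with z hz hne Q' hQ'
  by_cases h0 : Q'.eval (w : ℂ) 1 = 0
  · exact fun h2 => hne (UpperHalfPlane.ext
      (root_unique (posDef_of_mem_cls hQ hQ') z.im_pos w.im_pos h2 h0))
  · exact ((h z hz).2 ⟨Q', hQ'⟩ h0).1

/-! ### Growth towards the cusp -/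

theorem GQ_vadd (hk : 2 ≤ k) (hQ : Q.PosDef) (m : ℤ) (z : ℍ) :
    GQ k Q ((m : ℝ) +ᵥ z) = GQ k Q z := by
  have h := congrFun (GQ_slash k hk hQ (ModularGroup.T ^ m)) z
  rw [ModularForm.SL_slash_apply, ModularGroup.denom_apply, ModularGroup.coe_T_zpow,
    UpperHalfPlane.modular_T_zpow_smul] at h
  simpa using h

/-- `𝒢_Q` grows at most like `y^{2n+1}`. -/
theorem exists_growth_bound (hQ : Q.PosDef) (hn : 1 ≤ n) :
    ∃ B Y : ℝ, ∀ z : ℍ, Y ≤ z.im → ‖GQ (n + 1) Q z‖ ≤ B * Real.exp z.im := by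
  have hD := hQ.absDisc_pos
  have hpos := normFactor_pos n hQ
  have hsum := (summable_inv_size_pow hQ (k := n + 1) (by omega)).mul_left (6 ^ (n + 1))
  set S : ℝ := ∑' Q' : Q.cls, 6 ^ (n + 1) * (Q'.1.size ^ (n + 1))⁻¹ with hS
  have hS0 : 0 ≤ S := tsum_nonneg fun Q' => by
    have := (posDef_of_mem_cls hQ Q'.2).size_pos
    positivity
  refine ⟨normFactor n Q * (√Q.absDisc ^ (2 * n + 1) * (2 * n + 1).factorial * S),
    max 1 √(2 * Q.absDisc), fun z hz => ?_⟩
  wlog hre : |z.re| ≤ 1 generalizing z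
  · -- reduce to `|x| ≤ 1` by periodicity
    have h1 := this (((-round z.re : ℤ) : ℝ) +ᵥ z) (by simpa using hz) (by
      have h2 := abs_sub_round z.re
      have h3 : (((-round z.re : ℤ) : ℝ) +ᵥ z).re = z.re - round z.re := by
        simp
        ring
      rw [h3]
      linarith)
    rw [GQ_vadd (k := n + 1) (by omega) hQ] at h1
    simpa using h1
  have him1 : 1 ≤ (z : ℂ).im := (le_max_left _ _).trans hz
  have him2 : 2 * Q.absDisc ≤ (z : ℂ).im ^ 2 :=
    (Real.sqrt_le_left (by linarith)).1 ((le_max_right _ _).trans hz)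
  have him0 : 0 < (z : ℂ).im := z.im_pos
  have hbound : ∀ Q' : Q.cls, ‖term n Q'.1 z‖ ≤ (√Q.absDisc * (z : ℂ).im) ^ (2 * n + 1) *
      (6 ^ (n + 1) * (Q'.1.size ^ (n + 1))⁻¹) := by
    intro Q'
    have hQ' := posDef_of_mem_cls hQ Q'.2
    have hsz := hQ'.size_pos
    have h1 := size_le_norm_eval hQ' (z := z) hre him1 (by rwa [absDisc_of_mem_cls Q'.2])
    have hq : Q'.1.eval (z : ℂ) 1 ≠ 0 := norm_pos_iff.1 (lt_of_lt_of_le (by positivity) h1)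
    refine (norm_term_le n hQ' him0 hq).trans ?_
    rw [absDisc_of_mem_cls Q'.2]
    gcongr
    calc (‖Q'.1.eval (z : ℂ) 1‖ ^ (n + 1))⁻¹ ≤ ((Q'.1.size / 6) ^ (n + 1))⁻¹ :=
          inv_anti₀ (by positivity) (by gcongr)
      _ = _ := by rw [div_pow, inv_div, div_eq_mul_inv]
  have h2 : ‖termSum n Q z‖ ≤ (√Q.absDisc * (z : ℂ).im) ^ (2 * n + 1) * S := by
    rw [hS, ← tsum_mul_left]
    exact tsum_of_norm_bounded (hsum.mul_left _).hasSum hbound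
  have h3 : (z : ℂ).im ^ (2 * n + 1) ≤ (2 * n + 1).factorial * Real.exp (z : ℂ).im := by
    have h4 := Real.pow_div_factorial_le_exp (z : ℂ).im him0.le (2 * n + 1)
    rw [div_le_iff₀ (by positivity)] at h4
    linarith
  rw [GQ_eq, norm_mul, Complex.norm_real, Real.norm_of_nonneg hpos.le]
  calc _ ≤ normFactor n Q * ((√Q.absDisc * (z : ℂ).im) ^ (2 * n + 1) * S) := by gcongr
    _ = normFactor n Q * (√Q.absDisc ^ (2 * n + 1) * (z : ℂ).im ^ (2 * n + 1) * S) := by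
      rw [mul_pow]
    _ ≤ normFactor n Q * (√Q.absDisc ^ (2 * n + 1) *
        ((2 * n + 1).factorial * Real.exp (z : ℂ).im) * S) := by gcongr
    _ = _ := by
      rw [UpperHalfPlane.coe_im]
      ring

end IntBQF

end PolarMaass

end

/-! ### The main theorem -/

namespace PolarMaass.IntBQF

open UpperHalfPlane

variable {Q : IntBQF} {n : ℕ} {z : ℍ}

theorem analyticAt_GQ (hQ : Q.PosDef) (hn : 1 ≤ n)
    (hz : ∀ Q' ∈ Q.cls, Q'.eval (z : ℂ) 1 ≠ 0) : AnalyticAt ℝ (GQ (n + 1) Q ∘ ofComplex) z := by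
  obtain ⟨-, -, ha, -⟩ := termSum_properties hQ hn z.im_pos hz
  exact (analyticAt_const.mul ha).congr
    ((GQ_comp_ofComplex n Q).symm.eventuallyEq_of_mem (isOpen_im_pos.mem_nhds z.im_pos))

theorem nonanalyticSet_GQ (hQ : Q.PosDef) (hn : 1 ≤ n) :
    nonanalyticSet (GQ (n + 1) Q) = {z : ℍ | ∃ Q' ∈ Q.cls, Q'.eval (z : ℂ) 1 = 0} := by
  ext z
  refine ⟨fun h => ?_, ?_⟩
  · by_contra hz
    exact h (analyticAt_GQ hQ hn fun Q' hQ' h0 => hz ⟨Q', hQ', h0⟩)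
  · rintro ⟨Q', hQ', h0⟩ ha
    refine not_boundedNear hQ hn hQ' h0 ⟨‖(GQ (n + 1) Q ∘ ofComplex) z‖ + 1, ?_⟩
    have h1 := ha.continuousAt.norm.eventually (gt_mem_nhds (lt_add_one _))
    filter_upwards [eventually_coe.1 h1] with w hw
    simpa [ofComplex_apply] using hw.le

theorem wzbar_GQ (hQ : Q.PosDef) (hn : 1 ≤ n)
    (hz : ∀ Q' ∈ Q.cls, Q'.eval (z : ℂ) 1 ≠ 0) :
    ∀ᶠ w in 𝓝 (z : ℂ), wzbar (GQ (n + 1) Q ∘ ofComplex) w =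
      normFactor n Q * (Complex.I * √Q.absDisc / 2 * (Q.absDisc : ℂ) ^ n) *
        (w.im : ℂ) ^ (2 * n) * conj (invSum (n + 1) Q w) := by
  obtain ⟨-, -, ha, hbar, -⟩ := termSum_properties hQ hn z.im_pos hz
  filter_upwards [hbar, isOpen_im_pos.mem_nhds z.im_pos, ha.eventually_analyticAt] with w h1 h2 h3
  rw [wzbar_congr ((GQ_comp_ofComplex n Q).eventuallyEq_of_mem (isOpen_im_pos.mem_nhds h2))]
  have h4 : fderiv ℝ (fun z => (normFactor n Q : ℂ) * termSum n Q z) w =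
      (normFactor n Q : ℂ) • fderiv ℝ (termSum n Q) w := fderiv_const_mul h3.differentiableAt _
  have h5 : wzbar (fun z => (normFactor n Q : ℂ) * termSum n Q z) w =
      normFactor n Q * wzbar (termSum n Q) w := by
    simp only [wzbar, h4, smul_apply, smul_eq_mul]
    ring
  rw [h5, h1]
  ring

theorem xi_GQ (hQ : Q.PosDef) (hn : 1 ≤ n) (hz : ∀ Q' ∈ Q.cls, Q'.eval (z : ℂ) 1 ≠ 0) :
    xi (-(2 * n : ℕ)) (GQ (n + 1) Q) z = fQ (n + 1) Q z := by
  have h1 : dzbar (GQ (n + 1) Q) z = _ := (wzbar_GQ hQ hn hz).self_of_nhds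
  have hy : (z.im : ℂ) ≠ 0 := by exact_mod_cast z.im_ne_zero
  rw [xi, h1, fQ_eq n hQ, zpow_neg, zpow_natCast]
  simp only [map_mul, map_div₀, map_pow, Complex.conj_ofReal, Complex.conj_I, Complex.conj_conj,
    map_ofNat, coe_im]
  field_simp
  linear_combination
    -(normFactor n Q * √Q.absDisc * (Q.absDisc : ℂ) ^ n * invSum (n + 1) Q z) * Complex.I_sq

theorem calD_iterate_GQ (hQ : Q.PosDef) (hn : 1 ≤ n)
    (hz : ∀ Q' ∈ Q.cls, Q'.eval (z : ℂ) 1 ≠ 0) :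
    calD^[2 * n + 1] (GQ (n + 1) Q) z =
      -((Nat.factorial (2 * n) : ℂ) / (4 * (Real.pi : ℂ)) ^ (2 * n + 1)) * fQ (n + 1) Q z := by
  obtain ⟨-, -, -, -, -, hD⟩ := termSum_properties hQ hn z.im_pos hz
  have hpi : (Real.pi : ℂ) ≠ 0 := by exact_mod_cast Real.pi_ne_zero
  rw [calD_iterate, wz_iterate_congr isOpen_im_pos (GQ_comp_ofComplex n Q) _ z.im_pos,
    wz_iterate_const_mul]
  beta_reduce
  rw [hD, fQ_eq n hQ, neg_pow (Q.absDisc : ℂ)]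
  have hI : (1 / (2 * (Real.pi : ℂ) * Complex.I)) ^ (2 * n + 1) =
      (-1) ^ n * (-Complex.I) / (2 * Real.pi) ^ (2 * n + 1) := by
    have h1 : 1 / (2 * (Real.pi : ℂ) * Complex.I) = -Complex.I / (2 * Real.pi) := by
      field_simp
      simp
    rw [h1, div_pow, pow_succ (-Complex.I), pow_mul, neg_sq, Complex.I_sq]
  have h4 : (4 * (Real.pi : ℂ)) ^ (2 * n + 1) = 2 * 4 ^ n * (2 * Real.pi) ^ (2 * n + 1) := by
    have : (4 : ℂ) ^ n = 2 ^ (2 * n) := by rw [pow_mul]; norm_num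
    rw [show (4 : ℂ) * Real.pi = 2 * (2 * Real.pi) by ring, mul_pow 2, this]
    ring
  have hs : ((-1 : ℂ) ^ n) ^ 2 = 1 := by rw [← pow_mul, mul_comm, pow_mul]; simp
  rw [hI, h4]
  field_simp
  linear_combination (normFactor n Q * √Q.absDisc * (Q.absDisc : ℂ) ^ n * (2 * n).factorial *
    invSum (n + 1) Q z) * (Complex.I ^ 2 * hs + Complex.I_sq)

theorem isPolarHarmonicMaassForm_GQ (hQ : Q.PosDef) (hn : 1 ≤ n) :
    IsPolarHarmonicMaassForm (-(2 * n : ℕ)) 1 (GQ (n + 1) Q) := by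
  have hslash (M : SL(2, ℤ)) : (GQ (n + 1) Q) ∣[(-(2 * n : ℕ) : ℤ)] M = GQ (n + 1) Q := by
    have h := GQ_slash (n + 1) (by omega) hQ M
    rwa [show 2 - 2 * ((n + 1 : ℕ) : ℤ) = -(2 * n : ℕ) by push_cast; ring] at h
  refine ⟨fun w => ?_, fun M _ => hslash M, fun z hz => ?_, fun w => ?_, fun M => ?_⟩
  · filter_upwards [eventually_ne_zero hQ w] with z hz
    rw [nonanalyticSet_GQ hQ hn]
    rintro ⟨Q', hQ', h0⟩
    exact hz Q' hQ' h0
  · rw [nonanalyticSet_GQ hQ hn] at hz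
    have hz' : ∀ Q' ∈ Q.cls, Q'.eval (z : ℂ) 1 ≠ 0 := fun Q' hQ' h0 => hz ⟨Q', hQ', h0⟩
    obtain ⟨-, -, -, -, hf, -⟩ := termSum_properties hQ hn z.im_pos hz'
    exact hypLaplacian_eq_zero (analyticAt_GQ hQ hn hz') (wzbar_GQ hQ hn hz') hf.hasDerivAt
  · by_cases hw : ∃ Q' ∈ Q.cls, Q'.eval (w : ℂ) 1 = 0
    · obtain ⟨Q₀, h₀, hzero⟩ := hw
      exact ⟨n + 1, boundedNear_pow_mul hQ hn h₀ hzero⟩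
    · have ha := analyticAt_GQ hQ hn fun Q' hQ' h0 => hw ⟨Q', hQ', h0⟩
      refine ⟨0, ‖(GQ (n + 1) Q ∘ ofComplex) w‖ + 1, ?_⟩
      have h1 := ha.continuousAt.norm.eventually (gt_mem_nhds (lt_add_one _))
      filter_upwards [eventually_coe.1 h1] with z hz
      simpa [ofComplex_apply] using hz.le
  · obtain ⟨B, Y, h⟩ := exists_growth_bound hQ hn
    refine ⟨1, B, Y, fun z hz => ?_⟩
    rw [hslash, one_mul]
    exact h z hz

end PolarMaass.IntBQF

theorem theorem6p2 (k : ℕ) (hk : 2 ≤ k) (Q : IntBQF) (hQ : Q.PosDef) :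
    -- away from the orbit of `τ_Q` both defining series converge absolutely
    (∀ z : ℍ, z ∉ MulAction.orbit SL(2, ℤ) (Q.tau hQ) →
      Summable (fun Q' : Q.cls => ‖fTerm k Q' z‖) ∧
      Summable (fun Q' : Q.cls => ‖GTerm k Q' z‖)) ∧
    IsPolarHarmonicMaassForm (2 - 2 * (k : ℤ)) 1 (GQ k Q) ∧
    -- the singularities are exactly the points of the orbit of `τ_Q`
    nonanalyticSet (GQ k Q) = MulAction.orbit SL(2, ℤ) (Q.tau hQ) ∧
    (∀ w ∈ MulAction.orbit SL(2, ℤ) (Q.tau hQ), ¬ BoundedNear (GQ k Q) w) ∧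
    (∀ z : ℍ, z ∉ MulAction.orbit SL(2, ℤ) (Q.tau hQ) →
      xi (2 - 2 * (k : ℤ)) (GQ k Q) z = fQ k Q z) ∧
    (∀ z : ℍ, z ∉ MulAction.orbit SL(2, ℤ) (Q.tau hQ) →
      (calD^[2 * k - 1]) (GQ k Q) z =
        -((Nat.factorial (2 * k - 2) : ℂ) / (4 * (Real.pi : ℂ)) ^ (2 * k - 1)) * fQ k Q z) := by
  obtain ⟨n, rfl⟩ : ∃ n, k = n + 1 := ⟨k - 1, by omega⟩
  have hn : 1 ≤ n := by omega
  have hweight : 2 - 2 * ((n + 1 : ℕ) : ℤ) = -(2 * n : ℕ) := by push_cast; ring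
  have horbit : ∀ z : ℍ, z ∉ MulAction.orbit SL(2, ℤ) (Q.tau hQ) →
      ∀ Q' ∈ Q.cls, Q'.eval (z : ℂ) 1 ≠ 0 := fun z hz Q' hQ' h0 =>
    hz ((IntBQF.mem_orbit_tau_iff hQ z).2 ⟨Q', hQ', h0⟩)
  refine ⟨fun z hz => ?_, ?_, ?_, fun w hw => ?_, fun z hz => ?_, fun z hz => ?_⟩
  · obtain ⟨h1, h2, -⟩ := IntBQF.termSum_properties hQ hn z.im_pos (horbit z hz)
    simp only [IntBQF.fTerm_eq, IntBQF.GTerm_eq_term]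
    exact ⟨h1, h2⟩
  · rw [hweight]
    exact IntBQF.isPolarHarmonicMaassForm_GQ hQ hn
  · rw [IntBQF.nonanalyticSet_GQ hQ hn]
    ext z
    exact (IntBQF.mem_orbit_tau_iff hQ z).symm
  · obtain ⟨Q₀, h₀, hzero⟩ := (IntBQF.mem_orbit_tau_iff hQ w).1 hw
    exact IntBQF.not_boundedNear hQ hn h₀ hzero
  · rw [hweight]
    exact IntBQF.xi_GQ hQ hn (horbit z hz)
  · exact IntBQF.calD_iterate_GQ hQ hn (horbit z hz)
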